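/- **Second-order $\lambda^{\mathrm{PRK}}$.** Fix a denumerable set of type variables. Pure types are $A,B ::= \alpha \mid A\land B \mid A\lor B \mid A\to B \mid A\ltimes B \mid \neg A \mid \forall\alpha.A \mid \exists\alpha.A$; types are $P,Q ::= A^+ \mid A^- \mid A^\oplus \mid A^\ominus$. Terms, up to renaming of bound variables, with $i\in\{1,2\}$ and one sign $\pm\in\{+,-\}$ per constructor, are $$\begin{aligned} t,s,u ::=\;& x^P \mid t\bowtie_P s \mid \mathrm{IC}^\pm_{(x:P)}.\,t \mid t\bullet^\pm s \mid \langle t,s\rangle^\pm \mid \pi_i^\pm(t) \mid \mathrm{in}_i^\pm(t) \mid \delta^\pm t\,[_{(x:P)}.s][_{(y:Q)}.u] \mid \lambda^\pm_{(x:P)}.t \mid t\,@^\pm s \\ \mid\;& (t\,;s)^\pm \mid \varrho^\pm t\,[_{(x:P);(y:Q)}.s] \mid \nu^\pm t \mid \mu^\pm t \mid \Lambda^\pm_\alpha.t \mid t\,@^\pm A \mid \langle A,t\rangle^\pm \mid \nabla^\pm t\,[_{(\alpha,x:P)}.s]. \end{aligned}$$ A typing context $\Gamma$ is a finite assignment of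 types to variables. *Typing.* $\Gamma\vdash t:P$ is generated by the following rules and, for every rule except the first two, its dual, obtained by exchanging $+\leftrightarrow-$, $\oplus\leftrightarrow\ominus$, $\land\leftrightarrow\lor$, $\to\leftrightarrow\ltimes$, $\forall\leftrightarrow\exists$ (with $\neg$ unchanged): - $\Gamma,x:P\vdash x:P$; from $\Gamma\vdash t:A^+$ and $\Gamma\vdash s:A^-$ infer $\Gamma\vdash t\bowtie_P s:P$ for any $P$; - from $\Gamma,x:A^\ominus\vdash t:A^+$ infer $\mathrm{IC}^+_{(x:A^\ominus)}.t:A^\oplus$; from $t:A^\oplus$, $s:A^\ominus$ infer $t\bullet^+s:A^+$; - from $t:A^\oplus$, $s:B^\oplus$ infer $\langle t,s\rangle^+:(A\land B)^+$; from $t:(A_1\land A_2)^+$ infer $\pi_i^+(t):A_i^\oplus$; - from $t:A_i^\oplus$ infer $\mathrm{in}_i^+(t):(A_1\lor A_2)^+$; from $t:(A\lor B)^+$, $\Gamma,x:A^\oplus\vdash s:P$ and $\Gamma,y:B^\oplus\vdash u:P$ infer $\delta^+t[_{(x:A^\oplus)}.s][_{(y:B^\oplus)}.u]:P$; - from $\Gamma,x:A^\oplus\vdash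 t:B^\oplus$ infer $\lambda^+_{(x:A^\oplus)}.t:(A\to B)^+$; from $t:(A\to B)^+$, $s:A^\oplus$ infer $t\,@^+s:B^\oplus$; - from $t:A^\ominus$, $s:B^\oplus$ infer $(t;s)^+:(A\ltimes B)^+$; from $t:(A\ltimes B)^+$ and $\Gamma,x:A^\ominus,y:B^\oplus\vdash s:P$ infer $\varrho^+t[_{(x:A^\ominus);(y:B^\oplus)}.s]:P$; - from $t:A^\ominus$ infer $\nu^+t:(\neg A)^+$; from $t:(\neg A)^+$ infer $\mu^+t:A^\ominus$; - from $\Gamma\vdash t:A^\oplus$, $\alpha\notin\mathrm{ftv}(\Gamma)$ infer $\Lambda^+_\alpha.t:(\forall\alpha.A)^+$; from $t:(\forall\alpha.B)^+$ infer $t\,@^+A:B^\oplus[\alpha:=A]$; - from $t:B^\oplus[\alpha:=A]$ infer $\langle A,t\rangle^+:(\exists\alpha.B)^+$; from $t:(\exists\alpha.A)^+$, $\Gamma,x:A^\oplus\vdash s:P$, $\alpha\notin\mathrm{ftv}(\Gamma,P)$ infer $\nabla^+t[_{(\alpha,x:A^\oplus)}.s]:P$. *Reduction* $\to$ is the closure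 under arbitrary contexts of the following rules (equal signs within a rule; no $\eta$-rule). For $t$ of type $A^\oplus$ and $s$ of type $A^\ominus$ write $t\,\overline{\bowtie}_Q\,s = (t\bullet^+s)\bowtie_Q(s\bullet^-t)$, and for $t$ of type $A^\ominus$ and $s$ of type $A^\oplus$ write $t\,\overline{\bowtie}_Q\,s=(s\bullet^+t)\bowtie_Q(t\bullet^-s)$. The $\beta$-rules: $(\mathrm{IC}^\pm_x.t)\bullet^\pm s\to t[x:=s]$; $\pi_i^\pm\langle t_1,t_2\rangle^\pm\to t_i$; $\delta^\pm(\mathrm{in}_i^\pm t)[_x.s_1][_x.s_2]\to s_i[x:=t]$; $(\lambda^\pm_x.t)@^\pm s\to t[x:=s]$; $\varrho^\pm(t;s)^\pm[_{x;y}.u]\to u[x:=t][y:=s]$; $\mu^\pm(\nu^\pm t)\to t$; $(\Lambda^\pm_\alpha.t)@^\pm A\to t[\alpha:=A]$; $\nabla^\pm\langle A,t\rangle^\pm[_{(\alpha,x)}.s]\to s[\alpha:=A][x:=t]$. The absurdity rules: $\langle t_1,t_2\rangle^+\bowtie_Q\mathrm{in}_i^-s\to t_i\overline{\bowtie}_Qs$;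 $\mathrm{in}_i^+t\bowtie_Q\langle s_1,s_2\rangle^-\to t\,\overline{\bowtie}_Qs_i$; $(\lambda^+_x.t)\bowtie_Q(s;u)^-\to t[x:=s]\,\overline{\bowtie}_Qu$; $(t;s)^+\bowtie_Q(\lambda^-_x.u)\to s\,\overline{\bowtie}_Q\,u[x:=t]$; $\nu^+t\bowtie_Q\nu^-s\to t\,\overline{\bowtie}_Qs$ (here $t:A^\ominus$, in all other rules the left argument has a type $A^\oplus$); $(\Lambda^+_\alpha.t)\bowtie_Q\langle A,s\rangle^-\to t[\alpha:=A]\,\overline{\bowtie}_Qs$; $\langle A,t\rangle^+\bowtie_Q(\Lambda^-_\alpha.s)\to t\,\overline{\bowtie}_Q\,s[\alpha:=A]$. **Untyped terms.** The erasure $|t|$ of a term $t$ removes all signs and type annotations, replaces types and type variables in the quantifier constructors by a placeholder $\Diamond$, and identifies $\mathrm{IC}$, $\bullet$ with $\lambda$, $@$. Let $\mathbf U$ be the set of untyped terms so obtained (variables, $a\bowtie b$, $\langle a,b\rangle$, $\pi_i(a)$, $\mathrm{in}_i(a)$, $\delta a[_x.b][_y.c]$, $\lambda_x.a$, $a\,@\,b$,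 $(a;b)$, $\varrho a[_{x;y}.b]$, $\nu a$, $\mu a$, $\Lambda_\Diamond.a$, $a\,@\,\Diamond$, $\langle\Diamond,a\rangle$, $\nabla a[_x.b]$). Reduction $\to_{\mathbf U}$ on $\mathbf U$ is given by the erased versions of the rules above, closed under arbitrary contexts; here $a\,\overline{\bowtie}\,b=(a@b)\bowtie(b@a)$ and the rule for $\nu$ reads $\nu a\bowtie\nu b\to_{\mathbf U} b\,\overline{\bowtie}\,a$. $\mathbf{SN}\subseteq\mathbf U$ is the set of strongly normalizing terms, and $\mathbf{CAN}\subseteq\mathbf U$ the set of terms of one of the forms $\langle a,b\rangle$, $\mathrm{in}_i(a)$, $\lambda_x.a$, $(a;b)$, $\nu a$, $\Lambda_\Diamond.a$, $\langle\Diamond,a\rangle$. **Reducibility candidates.** A set $\xi\subseteq\mathbf{SN}$ is a reducibility candidate if it is closed under $\to_{\mathbf U}$ and every $a\in\mathbf{SN}$ all of whose reducts in $\mathbf{CAN}$ (in zero or more steps) belong to $\xi$ is itself in $\xi$. Ordered by inclusion, the set $\mathbf{RC}$ of candidates is a complete lattice. For $X\subseteq\mathbf{CAN}$ let $\mathrm{cl}(X)$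 be the set of $a\in\mathbf{SN}$ all of whose reducts in $\mathbf{CAN}$ are in $X$. Define the following operations on candidates: $\xi_1\times\xi_2=\mathrm{cl}\{\langle a_1,a_2\rangle : a_j\in\xi_j\}$; $\xi_1+\xi_2=\mathrm{cl}\{\mathrm{in}_i(a): i\in\{1,2\},\,a\in\xi_i\}$; $\xi_1\to\xi_2=\{a\in\mathbf{SN}:\forall b\in\xi_1,\ a@b\in\xi_2\}$; $\xi_1\ltimes\xi_2=\mathrm{cl}\{(a_1;a_2):a_j\in\xi_j\}$; ${\sim}\xi=\mathrm{cl}\{\nu a:a\in\xi\}$; $\prod_{i\in I}\xi_i=\{a\in\mathbf{SN}:\forall i,\ a@\Diamond\in\xi_i\}$; $\sum_{i\in I}\xi_i=\mathrm{cl}\{\langle\Diamond,a\rangle:\exists i,\ a\in\xi_i\}$. Candidates $\xi_1,\xi_2$ are orthogonal, $(\xi_1,\xi_2)\in{\perp\!\!\!\perp}$, if $a_1\bowtie a_2\in\mathbf{SN}$ for all $a_1\in\xi_1$, $a_2\in\xi_2$. An environment $\rho$ assigns to each type variable $\alpha$ an orthogonal pair $(\rho(\alpha^+),\rho(\alpha^-))$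 of candidates. The candidate $[\![P]\!]_\rho$ is defined by recursion on the size of the type: $[\![\alpha^\pm]\!]_\rho=\rho(\alpha^\pm)$; $[\![(A\land B)^+]\!]_\rho=[\![A^\oplus]\!]_\rho\times[\![B^\oplus]\!]_\rho$, $[\![(A\land B)^-]\!]_\rho=[\![A^\ominus]\!]_\rho+[\![B^\ominus]\!]_\rho$; $[\![(A\lor B)^+]\!]_\rho=[\![A^\oplus]\!]_\rho+[\![B^\oplus]\!]_\rho$, $[\![(A\lor B)^-]\!]_\rho=[\![A^\ominus]\!]_\rho\times[\![B^\ominus]\!]_\rho$; $[\![(A\to B)^+]\!]_\rho=[\![A^\oplus]\!]_\rho\to[\![B^\oplus]\!]_\rho$, $[\![(A\to B)^-]\!]_\rho=[\![A^\oplus]\!]_\rho\ltimes[\![B^\ominus]\!]_\rho$; $[\![(A\ltimes B)^+]\!]_\rho=[\![A^\ominus]\!]_\rho\ltimes[\![B^\oplus]\!]_\rho$, $[\![(A\ltimes B)^-]\!]_\rho=[\![A^\ominus]\!]_\rho\to[\![B^\ominus]\!]_\rho$; $[\![(\neg A)^+]\!]_\rho={\sim}[\![A^\ominus]\!]_\rho$,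 $[\![(\neg A)^-]\!]_\rho={\sim}[\![A^\oplus]\!]_\rho$; with $(\xi^+,\xi^-)$ ranging over ${\perp\!\!\!\perp}$ and $\rho'=\rho[\alpha:=\xi^+,\xi^-]$, $[\![(\forall\alpha.A)^+]\!]_\rho=\prod_{(\xi^+,\xi^-)}[\![A^\oplus]\!]_{\rho'}$, $[\![(\forall\alpha.A)^-]\!]_\rho=\sum_{(\xi^+,\xi^-)}[\![A^\ominus]\!]_{\rho'}$, $[\![(\exists\alpha.A)^+]\!]_\rho=\sum_{(\xi^+,\xi^-)}[\![A^\oplus]\!]_{\rho'}$, $[\![(\exists\alpha.A)^-]\!]_\rho=\prod_{(\xi^+,\xi^-)}[\![A^\ominus]\!]_{\rho'}$; and $[\![A^\oplus]\!]_\rho$ is the least fixed point in $\mathbf{RC}$ of $\xi\mapsto((\xi\to[\![A^-]\!]_\rho)\to[\![A^+]\!]_\rho)$, and $[\![A^\ominus]\!]_\rho$ is the greatest fixed point in $\mathbf{RC}$ of $\xi\mapsto((\xi\to[\![A^+]\!]_\rho)\to[\![A^-]\!]_\rho)$. A substitution $\sigma$ maps variables to untyped terms, and $a^\sigma$ is the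 capture-avoiding substitution of every free variable $x$ of $a\in\mathbf U$ by $\sigma(x)$. The substitution $\sigma$ is adequate for $\Gamma$ under $\rho$ if $\sigma(x)\in[\![P]\!]_\rho$ for every $(x:P)\in\Gamma$. **Theorem.** 1. (Adequacy) If $\Gamma\vdash t:P$, $\rho$ is an environment and $\sigma$ is adequate for $\Gamma$ under $\rho$, then $|t|^\sigma\in[\![P]\!]_\rho$. 2. (Strong normalization) If $\Gamma\vdash t:P$, then $t$ is strongly normalizing with respect to $\to$. -/

import Mathlib

/-
Second-order lambda-PRK: types, terms, typing, reduction, untyped terms, reducibility candidates.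
Terms modulo renaming of bound variables are represented with de Bruijn indices; term variables and
type variables are two separate families of indices, each indexed by `ℕ`.
-/

namespace PRK

/-- The sign `+` or `-` that decorates a term constructor. -/
inductive Sign where
  | pos
  | neg

/-- The index `i ∈ {1, 2}` of projections and injections. -/
inductive Idx where
  | one
  | two

/-- `i.pick x₁ x₂ = xᵢ`. -/
def Idx.pick {α : Type*} : Idx → α → α → α
  | .one, x, _ => x
  | .two, _, y => y

/-! ### Types -/

/-- Pure types. The quantifiers `all` and `ex` bind the type variable with index `0`. -/
inductive PureTy where
  | var (n : ℕ)
  | and (A B : PureTy)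
  | or (A B : PureTy)
  | imp (A B : PureTy)
  | coimp (A B : PureTy)
  | neg (A : PureTy)
  | all (A : PureTy)
  | ex (A : PureTy)

/-- Types: strong affirmation `pos`, strong denial `neg`, weak affirmation `wpos` and
weak denial `wneg` of a pure type. -/
inductive Ty where
  | pos (A : PureTy)
  | neg (A : PureTy)
  | wpos (A : PureTy)
  | wneg (A : PureTy)

/-- A renaming `f` of indices under one more binder. -/
def upRen (f : ℕ → ℕ) : ℕ → ℕ
  | 0 => 0
  | n + 1 => f n + 1

namespace PureTy

def rename : PureTy → (ℕ → ℕ) → PureTy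
  | var n, f => var (f n)
  | and A B, f => and (A.rename f) (B.rename f)
  | or A B, f => or (A.rename f) (B.rename f)
  | imp A B, f => imp (A.rename f) (B.rename f)
  | coimp A B, f => coimp (A.rename f) (B.rename f)
  | neg A, f => neg (A.rename f)
  | all A, f => all (A.rename (upRen f))
  | ex A, f => ex (A.rename (upRen f))

/-- A type substitution under one more type binder. -/
def up (τ : ℕ → PureTy) : ℕ → PureTy
  | 0 => var 0
  | n + 1 => (τ n).rename Nat.succ

/-- Simultaneous capture-avoiding substitution of type variables. -/
def subst : PureTy → (ℕ → PureTy) → PureTy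
  | var n, τ => τ n
  | and A B, τ => and (A.subst τ) (B.subst τ)
  | or A B, τ => or (A.subst τ) (B.subst τ)
  | imp A B, τ => imp (A.subst τ) (B.subst τ)
  | coimp A B, τ => coimp (A.subst τ) (B.subst τ)
  | neg A, τ => neg (A.subst τ)
  | all A, τ => all (A.subst (up τ))
  | ex A, τ => ex (A.subst (up τ))

/-- The type substitution that replaces the outermost bound type variable by `A` and removes
its binder. -/
def single (A : PureTy) : ℕ → PureTy
  | 0 => A
  | n + 1 => var n

/-- The type substitution that moves a type under one more type binder. -/
def weak (n : ℕ) : PureTy := var (n + 1)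

/-- `B.inst A` is `B[α := A]`, where `α` has index `0` in `B`. -/
def inst (B A : PureTy) : PureTy := B.subst (single A)

/-- The number of symbols. -/
def size : PureTy → ℕ
  | var _ => 1
  | and A B => A.size + B.size + 1
  | or A B => A.size + B.size + 1
  | imp A B => A.size + B.size + 1
  | coimp A B => A.size + B.size + 1
  | neg A => A.size + 1
  | all A => A.size + 1
  | ex A => A.size + 1

end PureTy

namespace Ty

def subst : Ty → (ℕ → PureTy) → Ty
  | pos A, τ => pos (A.subst τ)
  | neg A, τ => neg (A.subst τ)
  | wpos A, τ => wpos (A.subst τ)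
  | wneg A, τ => wneg (A.subst τ)

/-- The type `P` moved under one more type binder, whose variable does not occur in the result. -/
def tshift (P : Ty) : Ty := P.subst PureTy.weak

def measure : Ty → ℕ
  | pos A => 2 * A.size
  | neg A => 2 * A.size
  | wpos A => 2 * A.size + 1
  | wneg A => 2 * A.size + 1

end Ty

/-! ### Terms -/

/-- Terms. Binding structure: `wlam s P t` and `lam s P t` bind one term variable (of type `P`)
in `t`; `case s t P u Q v` binds one in `u` and one in `v`; `colam s t P Q u` binds two in `u`, the
one of type `P` with index `1` and the one of type `Q` with index `0`; `tlam s t` binds a type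
variable in `t`; `opn s t P u` binds a type variable in `P` and `u`, and a term variable of type
`P` in `u`. -/
inductive Tm where
  /-- a variable, annotated with its type -/
  | var (x : ℕ) (P : Ty)
  /-- absurdity, annotated with the type of the whole term -/
  | abs (P : Ty) (t s : Tm)
  | wlam (e : Sign) (P : Ty) (t : Tm)
  | wapp (e : Sign) (t s : Tm)
  | pair (e : Sign) (t s : Tm)
  | proj (e : Sign) (i : Idx) (t : Tm)
  | inj (e : Sign) (i : Idx) (t : Tm)
  | case (e : Sign) (t : Tm) (P : Ty) (u : Tm) (Q : Ty) (v : Tm)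
  | lam (e : Sign) (P : Ty) (t : Tm)
  | app (e : Sign) (t s : Tm)
  | copair (e : Sign) (t s : Tm)
  | colam (e : Sign) (t : Tm) (P Q : Ty) (u : Tm)
  | negi (e : Sign) (t : Tm)
  | nege (e : Sign) (t : Tm)
  | tlam (e : Sign) (t : Tm)
  | tapp (e : Sign) (t : Tm) (A : PureTy)
  | pack (e : Sign) (A : PureTy) (t : Tm)
  | opn (e : Sign) (t : Tm) (P : Ty) (u : Tm)

namespace Tm

/-- Simultaneous capture-avoiding substitution of type variables in a term. -/
def tsubst : Tm → (ℕ → PureTy) → Tm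
  | var x P, τ => var x (P.subst τ)
  | abs P t s, τ => abs (P.subst τ) (t.tsubst τ) (s.tsubst τ)
  | wlam e P t, τ => wlam e (P.subst τ) (t.tsubst τ)
  | wapp e t s, τ => wapp e (t.tsubst τ) (s.tsubst τ)
  | pair e t s, τ => pair e (t.tsubst τ) (s.tsubst τ)
  | proj e i t, τ => proj e i (t.tsubst τ)
  | inj e i t, τ => inj e i (t.tsubst τ)
  | case e t P u Q v, τ =>
      case e (t.tsubst τ) (P.subst τ) (u.tsubst τ) (Q.subst τ) (v.tsubst τ)
  | lam e P t, τ => lam e (P.subst τ) (t.tsubst τ)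
  | app e t s, τ => app e (t.tsubst τ) (s.tsubst τ)
  | copair e t s, τ => copair e (t.tsubst τ) (s.tsubst τ)
  | colam e t P Q u, τ => colam e (t.tsubst τ) (P.subst τ) (Q.subst τ) (u.tsubst τ)
  | negi e t, τ => negi e (t.tsubst τ)
  | nege e t, τ => nege e (t.tsubst τ)
  | tlam e t, τ => tlam e (t.tsubst (PureTy.up τ))
  | tapp e t A, τ => tapp e (t.tsubst τ) (A.subst τ)
  | pack e A t, τ => pack e (A.subst τ) (t.tsubst τ)
  | opn e t P u, τ =>
      opn e (t.tsubst τ) (P.subst (PureTy.up τ)) (u.tsubst (PureTy.up τ))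

/-- The term moved under one more type binder. -/
def tshift (t : Tm) : Tm := t.tsubst PureTy.weak

/-- `t.tinst A` is `t[α := A]`, where the type variable `α` has index `0` in `t`. -/
def tinst (t : Tm) (A : PureTy) : Tm := t.tsubst (PureTy.single A)

/-- Renaming of term variables. -/
def rename : Tm → (ℕ → ℕ) → Tm
  | var x P, f => var (f x) P
  | abs P t s, f => abs P (t.rename f) (s.rename f)
  | wlam e P t, f => wlam e P (t.rename (upRen f))
  | wapp e t s, f => wapp e (t.rename f) (s.rename f)
  | pair e t s, f => pair e (t.rename f) (s.rename f)
  | proj e i t, f => proj e i (t.rename f)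
  | inj e i t, f => inj e i (t.rename f)
  | case e t P u Q v, f =>
      case e (t.rename f) P (u.rename (upRen f)) Q (v.rename (upRen f))
  | lam e P t, f => lam e P (t.rename (upRen f))
  | app e t s, f => app e (t.rename f) (s.rename f)
  | copair e t s, f => copair e (t.rename f) (s.rename f)
  | colam e t P Q u, f => colam e (t.rename f) P Q (u.rename (upRen (upRen f)))
  | negi e t, f => negi e (t.rename f)
  | nege e t, f => nege e (t.rename f)
  | tlam e t, f => tlam e (t.rename f)
  | tapp e t A, f => tapp e (t.rename f) A
  | pack e A t, f => pack e A (t.rename f)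
  | opn e t P u, f => opn e (t.rename f) P (u.rename (upRen f))

/-- The term moved under one more term binder. -/
def shift (t : Tm) : Tm := t.rename Nat.succ

/-- `t.subst k r` is the capture-avoiding substitution of `r` for the variable with index `k`
in `t`; that variable disappears, so larger indices go down by one. -/
def subst : Tm → ℕ → Tm → Tm
  | var x P, k, r => if x < k then var x P else if x = k then r else var (x - 1) P
  | abs P t s, k, r => abs P (t.subst k r) (s.subst k r)
  | wlam e P t, k, r => wlam e P (t.subst (k + 1) r.shift)
  | wapp e t s, k, r => wapp e (t.subst k r) (s.subst k r)
  | pair e t s, k, r => pair e (t.subst k r) (s.subst k r)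
  | proj e i t, k, r => proj e i (t.subst k r)
  | inj e i t, k, r => inj e i (t.subst k r)
  | case e t P u Q v, k, r =>
      case e (t.subst k r) P (u.subst (k + 1) r.shift) Q (v.subst (k + 1) r.shift)
  | lam e P t, k, r => lam e P (t.subst (k + 1) r.shift)
  | app e t s, k, r => app e (t.subst k r) (s.subst k r)
  | copair e t s, k, r => copair e (t.subst k r) (s.subst k r)
  | colam e t P Q u, k, r => colam e (t.subst k r) P Q (u.subst (k + 2) r.shift.shift)
  | negi e t, k, r => negi e (t.subst k r)
  | nege e t, k, r => nege e (t.subst k r)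
  | tlam e t, k, r => tlam e (t.subst k r.tshift)
  | tapp e t A, k, r => tapp e (t.subst k r) A
  | pack e A t, k, r => pack e A (t.subst k r)
  | opn e t P u, k, r => opn e (t.subst k r) P (u.subst (k + 1) r.tshift.shift)

/-- `t.inst r` is `t[x := r]`, where the variable `x` has index `0` in `t`. -/
def inst (t r : Tm) : Tm := t.subst 0 r

/-- `u.inst₂ t s` is `u[x := t][y := s]`, where `x` has index `1` and `y` has index `0` in `u`. -/
def inst₂ (u t s : Tm) : Tm := (u.subst 1 t.shift).subst 0 s

/-- Generalized absurdity of type `Q` for `t` of a weak affirmation type `A^⊕` and `s` of the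
opposite type `A^⊖`. -/
def absWpos (Q : Ty) (t s : Tm) : Tm := abs Q (wapp .pos t s) (wapp .neg s t)

/-- Generalized absurdity of type `Q` for `t` of a weak denial type `A^⊖` and `s` of the
opposite type `A^⊕`. -/
def absWneg (Q : Ty) (t s : Tm) : Tm := abs Q (wapp .pos s t) (wapp .neg t s)

/-- One-step reduction (without eta): the rewriting rules, closed under arbitrary contexts. -/
inductive Step : Tm → Tm → Prop
  | beta_weak (e P t s) : Step (wapp e (wlam e P t) s) (t.inst s)
  | beta_pair (e i t₁ t₂) : Step (proj e i (pair e t₁ t₂)) (i.pick t₁ t₂)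
  | beta_case (e i t P s₁ Q s₂) :
      Step (case e (inj e i t) P s₁ Q s₂) ((i.pick s₁ s₂).inst t)
  | beta_lam (e P t s) : Step (app e (lam e P t) s) (t.inst s)
  | beta_copair (e t s P Q u) : Step (colam e (copair e t s) P Q u) (u.inst₂ t s)
  | beta_neg (e t) : Step (nege e (negi e t)) t
  | beta_tlam (e t A) : Step (tapp e (tlam e t) A) (t.tinst A)
  | beta_pack (e A t P s) : Step (opn e (pack e A t) P s) ((s.tinst A).inst t)
  | abs_and (Q t₁ t₂ i s) :
      Step (abs Q (pair .pos t₁ t₂) (inj .neg i s)) (absWpos Q (i.pick t₁ t₂) s)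
  | abs_or (Q i t s₁ s₂) :
      Step (abs Q (inj .pos i t) (pair .neg s₁ s₂)) (absWpos Q t (i.pick s₁ s₂))
  | abs_imp (Q P t s u) :
      Step (abs Q (lam .pos P t) (copair .neg s u)) (absWpos Q (t.inst s) u)
  | abs_coimp (Q t s P u) :
      Step (abs Q (copair .pos t s) (lam .neg P u)) (absWpos Q s (u.inst t))
  | abs_neg (Q t s) : Step (abs Q (negi .pos t) (negi .neg s)) (absWneg Q t s)
  | abs_all (Q t A s) :
      Step (abs Q (tlam .pos t) (pack .neg A s)) (absWpos Q (t.tinst A) s)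
  | abs_ex (Q A t s) :
      Step (abs Q (pack .pos A t) (tlam .neg s)) (absWpos Q t (s.tinst A))
  | abs₁ {t t'} (P s) : Step t t' → Step (abs P t s) (abs P t' s)
  | abs₂ {s s'} (P t) : Step s s' → Step (abs P t s) (abs P t s')
  | wlam {t t'} (e P) : Step t t' → Step (wlam e P t) (wlam e P t')
  | wapp₁ {t t'} (e s) : Step t t' → Step (wapp e t s) (wapp e t' s)
  | wapp₂ {s s'} (e t) : Step s s' → Step (wapp e t s) (wapp e t s')
  | pair₁ {t t'} (e s) : Step t t' → Step (pair e t s) (pair e t' s)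
  | pair₂ {s s'} (e t) : Step s s' → Step (pair e t s) (pair e t s')
  | proj {t t'} (e i) : Step t t' → Step (proj e i t) (proj e i t')
  | inj {t t'} (e i) : Step t t' → Step (inj e i t) (inj e i t')
  | case₁ {t t'} (e P u Q v) : Step t t' → Step (case e t P u Q v) (case e t' P u Q v)
  | case₂ {u u'} (e t P Q v) : Step u u' → Step (case e t P u Q v) (case e t P u' Q v)
  | case₃ {v v'} (e t P u Q) : Step v v' → Step (case e t P u Q v) (case e t P u Q v')
  | lam {t t'} (e P) : Step t t' → Step (lam e P t) (lam e P t')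
  | app₁ {t t'} (e s) : Step t t' → Step (app e t s) (app e t' s)
  | app₂ {s s'} (e t) : Step s s' → Step (app e t s) (app e t s')
  | copair₁ {t t'} (e s) : Step t t' → Step (copair e t s) (copair e t' s)
  | copair₂ {s s'} (e t) : Step s s' → Step (copair e t s) (copair e t s')
  | colam₁ {t t'} (e P Q u) : Step t t' → Step (colam e t P Q u) (colam e t' P Q u)
  | colam₂ {u u'} (e t P Q) : Step u u' → Step (colam e t P Q u) (colam e t P Q u')
  | negi {t t'} (e) : Step t t' → Step (negi e t) (negi e t')
  | nege {t t'} (e) : Step t t' → Step (nege e t) (nege e t')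
  | tlam {t t'} (e) : Step t t' → Step (tlam e t) (tlam e t')
  | tapp {t t'} (e A) : Step t t' → Step (tapp e t A) (tapp e t' A)
  | pack {t t'} (e A) : Step t t' → Step (pack e A t) (pack e A t')
  | opn₁ {t t'} (e P u) : Step t t' → Step (opn e t P u) (opn e t' P u)
  | opn₂ {u u'} (e t P) : Step u u' → Step (opn e t P u) (opn e t P u')

/-- Strong normalization: every reduction sequence from the term is finite. -/
def SN (t : Tm) : Prop := Acc (fun s' s => Step s s') t

end Tm

/-! ### Typing -/

/-- A typing context: a finite assignment of types to variables. -/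
structure Ctx where
  get : ℕ → Option Ty
  finite_dom : {x | get x ≠ none}.Finite

/-- The context `Γ, x : P`, where the new variable `x` has index `0`. -/
def Ctx.cons (P : Ty) (Γ : Ctx) : Ctx where
  get
    | 0 => some P
    | x + 1 => Γ.get x
  finite_dom := by
    refine ((Γ.finite_dom.image Nat.succ).insert 0).subset ?_
    rintro (_ | x) hx
    · exact Set.mem_insert _ _
    · exact Set.mem_insert_of_mem _ ⟨x, hx, rfl⟩

/-- The context `Γ` moved under one more type binder; the new type variable (index `0`) does not
occur in it. -/
def Ctx.tshift (Γ : Ctx) : Ctx where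
  get x := (Γ.get x).map Ty.tshift
  finite_dom := by simpa using Γ.finite_dom

/-- Derivable typing judgments `Γ ⊢ t : P`. -/
inductive HasType : Ctx → Tm → Ty → Prop
  | ax {Γ : Ctx} {x : ℕ} {P : Ty} : Γ.get x = some P → HasType Γ (.var x P) P
  | abs {Γ : Ctx} {t s : Tm} {A : PureTy} (P : Ty) :
      HasType Γ t (.pos A) → HasType Γ s (.neg A) → HasType Γ (.abs P t s) P
  | wlam_pos {Γ : Ctx} {t : Tm} {A : PureTy} :
      HasType (Γ.cons (.wneg A)) t (.pos A) → HasType Γ (.wlam .pos (.wneg A) t) (.wpos A)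
  | wlam_neg {Γ : Ctx} {t : Tm} {A : PureTy} :
      HasType (Γ.cons (.wpos A)) t (.neg A) → HasType Γ (.wlam .neg (.wpos A) t) (.wneg A)
  | wapp_pos {Γ : Ctx} {t s : Tm} {A : PureTy} :
      HasType Γ t (.wpos A) → HasType Γ s (.wneg A) → HasType Γ (.wapp .pos t s) (.pos A)
  | wapp_neg {Γ : Ctx} {t s : Tm} {A : PureTy} :
      HasType Γ t (.wneg A) → HasType Γ s (.wpos A) → HasType Γ (.wapp .neg t s) (.neg A)
  | pair_pos {Γ : Ctx} {t s : Tm} {A B : PureTy} :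
      HasType Γ t (.wpos A) → HasType Γ s (.wpos B) →
        HasType Γ (.pair .pos t s) (.pos (.and A B))
  | pair_neg {Γ : Ctx} {t s : Tm} {A B : PureTy} :
      HasType Γ t (.wneg A) → HasType Γ s (.wneg B) →
        HasType Γ (.pair .neg t s) (.neg (.or A B))
  | proj_pos {Γ : Ctx} {t : Tm} {A B : PureTy} (i : Idx) :
      HasType Γ t (.pos (.and A B)) → HasType Γ (.proj .pos i t) (.wpos (i.pick A B))
  | proj_neg {Γ : Ctx} {t : Tm} {A B : PureTy} (i : Idx) :
      HasType Γ t (.neg (.or A B)) → HasType Γ (.proj .neg i t) (.wneg (i.pick A B))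
  | inj_pos {Γ : Ctx} {t : Tm} {A B : PureTy} (i : Idx) :
      HasType Γ t (.wpos (i.pick A B)) → HasType Γ (.inj .pos i t) (.pos (.or A B))
  | inj_neg {Γ : Ctx} {t : Tm} {A B : PureTy} (i : Idx) :
      HasType Γ t (.wneg (i.pick A B)) → HasType Γ (.inj .neg i t) (.neg (.and A B))
  | case_pos {Γ : Ctx} {t s u : Tm} {A B : PureTy} {P : Ty} :
      HasType Γ t (.pos (.or A B)) → HasType (Γ.cons (.wpos A)) s P →
        HasType (Γ.cons (.wpos B)) u P → HasType Γ (.case .pos t (.wpos A) s (.wpos B) u) P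
  | case_neg {Γ : Ctx} {t s u : Tm} {A B : PureTy} {P : Ty} :
      HasType Γ t (.neg (.and A B)) → HasType (Γ.cons (.wneg A)) s P →
        HasType (Γ.cons (.wneg B)) u P → HasType Γ (.case .neg t (.wneg A) s (.wneg B) u) P
  | lam_pos {Γ : Ctx} {t : Tm} {A B : PureTy} :
      HasType (Γ.cons (.wpos A)) t (.wpos B) →
        HasType Γ (.lam .pos (.wpos A) t) (.pos (.imp A B))
  | lam_neg {Γ : Ctx} {t : Tm} {A B : PureTy} :
      HasType (Γ.cons (.wneg A)) t (.wneg B) →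
        HasType Γ (.lam .neg (.wneg A) t) (.neg (.coimp A B))
  | app_pos {Γ : Ctx} {t s : Tm} {A B : PureTy} :
      HasType Γ t (.pos (.imp A B)) → HasType Γ s (.wpos A) → HasType Γ (.app .pos t s) (.wpos B)
  | app_neg {Γ : Ctx} {t s : Tm} {A B : PureTy} :
      HasType Γ t (.neg (.coimp A B)) → HasType Γ s (.wneg A) →
        HasType Γ (.app .neg t s) (.wneg B)
  | copair_pos {Γ : Ctx} {t s : Tm} {A B : PureTy} :
      HasType Γ t (.wneg A) → HasType Γ s (.wpos B) →
        HasType Γ (.copair .pos t s) (.pos (.coimp A B))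
  | copair_neg {Γ : Ctx} {t s : Tm} {A B : PureTy} :
      HasType Γ t (.wpos A) → HasType Γ s (.wneg B) →
        HasType Γ (.copair .neg t s) (.neg (.imp A B))
  | colam_pos {Γ : Ctx} {t s : Tm} {A B : PureTy} {P : Ty} :
      HasType Γ t (.pos (.coimp A B)) → HasType ((Γ.cons (.wneg A)).cons (.wpos B)) s P →
        HasType Γ (.colam .pos t (.wneg A) (.wpos B) s) P
  | colam_neg {Γ : Ctx} {t s : Tm} {A B : PureTy} {P : Ty} :
      HasType Γ t (.neg (.imp A B)) → HasType ((Γ.cons (.wpos A)).cons (.wneg B)) s P →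
        HasType Γ (.colam .neg t (.wpos A) (.wneg B) s) P
  | negi_pos {Γ : Ctx} {t : Tm} {A : PureTy} :
      HasType Γ t (.wneg A) → HasType Γ (.negi .pos t) (.pos (.neg A))
  | negi_neg {Γ : Ctx} {t : Tm} {A : PureTy} :
      HasType Γ t (.wpos A) → HasType Γ (.negi .neg t) (.neg (.neg A))
  | nege_pos {Γ : Ctx} {t : Tm} {A : PureTy} :
      HasType Γ t (.pos (.neg A)) → HasType Γ (.nege .pos t) (.wneg A)
  | nege_neg {Γ : Ctx} {t : Tm} {A : PureTy} :
      HasType Γ t (.neg (.neg A)) → HasType Γ (.nege .neg t) (.wpos A)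
  | tlam_pos {Γ : Ctx} {t : Tm} {A : PureTy} :
      HasType Γ.tshift t (.wpos A) → HasType Γ (.tlam .pos t) (.pos (.all A))
  | tlam_neg {Γ : Ctx} {t : Tm} {A : PureTy} :
      HasType Γ.tshift t (.wneg A) → HasType Γ (.tlam .neg t) (.neg (.ex A))
  | tapp_pos {Γ : Ctx} {t : Tm} {B : PureTy} (A : PureTy) :
      HasType Γ t (.pos (.all B)) → HasType Γ (.tapp .pos t A) (.wpos (B.inst A))
  | tapp_neg {Γ : Ctx} {t : Tm} {B : PureTy} (A : PureTy) :
      HasType Γ t (.neg (.ex B)) → HasType Γ (.tapp .neg t A) (.wneg (B.inst A))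
  | pack_pos {Γ : Ctx} {t : Tm} {A B : PureTy} :
      HasType Γ t (.wpos (B.inst A)) → HasType Γ (.pack .pos A t) (.pos (.ex B))
  | pack_neg {Γ : Ctx} {t : Tm} {A B : PureTy} :
      HasType Γ t (.wneg (B.inst A)) → HasType Γ (.pack .neg A t) (.neg (.all B))
  | opn_pos {Γ : Ctx} {t s : Tm} {A : PureTy} {P : Ty} :
      HasType Γ t (.pos (.ex A)) → HasType (Γ.tshift.cons (.wpos A)) s P.tshift →
        HasType Γ (.opn .pos t (.wpos A) s) P
  | opn_neg {Γ : Ctx} {t s : Tm} {A : PureTy} {P : Ty} :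
      HasType Γ t (.neg (.all A)) → HasType (Γ.tshift.cons (.wneg A)) s P.tshift →
        HasType Γ (.opn .neg t (.wneg A) s) P

/-! ### Untyped terms -/

/-- Untyped terms. `lam a` binds one variable in `a`; `case a b c` binds one in `b` and one in `c`;
`colam a b` binds two in `b` (the first component has index `1`, the second one index `0`);
`opn a b` binds one in `b`. -/
inductive UTm where
  | var (x : ℕ)
  | abs (a b : UTm)
  | pair (a b : UTm)
  | proj (i : Idx) (a : UTm)
  | inj (i : Idx) (a : UTm)
  | case (a b c : UTm)
  | lam (a : UTm)
  | app (a b : UTm)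
  | copair (a b : UTm)
  | colam (a b : UTm)
  | negi (a : UTm)
  | nege (a : UTm)
  | tlam (a : UTm)
  | tapp (a : UTm)
  | pack (a : UTm)
  | opn (a b : UTm)

namespace UTm

def rename : UTm → (ℕ → ℕ) → UTm
  | var x, f => var (f x)
  | abs a b, f => abs (a.rename f) (b.rename f)
  | pair a b, f => pair (a.rename f) (b.rename f)
  | proj i a, f => proj i (a.rename f)
  | inj i a, f => inj i (a.rename f)
  | case a b c, f => case (a.rename f) (b.rename (upRen f)) (c.rename (upRen f))
  | lam a, f => lam (a.rename (upRen f))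
  | app a b, f => app (a.rename f) (b.rename f)
  | copair a b, f => copair (a.rename f) (b.rename f)
  | colam a b, f => colam (a.rename f) (b.rename (upRen (upRen f)))
  | negi a, f => negi (a.rename f)
  | nege a, f => nege (a.rename f)
  | tlam a, f => tlam (a.rename f)
  | tapp a, f => tapp (a.rename f)
  | pack a, f => pack (a.rename f)
  | opn a b, f => opn (a.rename f) (b.rename (upRen f))

/-- A substitution under one more binder. -/
def up (σ : ℕ → UTm) : ℕ → UTm
  | 0 => var 0
  | x + 1 => (σ x).rename Nat.succ

/-- `a.subst σ` is the simultaneous capture-avoiding substitution of every free variable `x` of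
`a` by `σ x`. -/
def subst : UTm → (ℕ → UTm) → UTm
  | var x, σ => σ x
  | abs a b, σ => abs (a.subst σ) (b.subst σ)
  | pair a b, σ => pair (a.subst σ) (b.subst σ)
  | proj i a, σ => proj i (a.subst σ)
  | inj i a, σ => inj i (a.subst σ)
  | case a b c, σ => case (a.subst σ) (b.subst (up σ)) (c.subst (up σ))
  | lam a, σ => lam (a.subst (up σ))
  | app a b, σ => app (a.subst σ) (b.subst σ)
  | copair a b, σ => copair (a.subst σ) (b.subst σ)
  | colam a b, σ => colam (a.subst σ) (b.subst (up (up σ)))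
  | negi a, σ => negi (a.subst σ)
  | nege a, σ => nege (a.subst σ)
  | tlam a, σ => tlam (a.subst σ)
  | tapp a, σ => tapp (a.subst σ)
  | pack a, σ => pack (a.subst σ)
  | opn a b, σ => opn (a.subst σ) (b.subst (up σ))

/-- The substitution that sends index `0` to `a` and index `x + 1` to `σ x`. -/
def scons (a : UTm) (σ : ℕ → UTm) : ℕ → UTm
  | 0 => a
  | x + 1 => σ x

/-- `b.inst a` is `b[x := a]`, where `x` has index `0` in `b`. -/
def inst (b a : UTm) : UTm := b.subst (scons a var)

/-- `b.inst₂ a₁ a₂` is `b[x := a₁][y := a₂]`, where `x` has index `1` and `y` has index `0`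
in `b`. -/
def inst₂ (b a₁ a₂ : UTm) : UTm := b.subst (scons a₂ (scons a₁ var))

/-- Generalized absurdity. -/
def gabs (a b : UTm) : UTm := abs (app a b) (app b a)

/-- One-step reduction of untyped terms: the reduction rules, closed under arbitrary contexts. -/
inductive Step : UTm → UTm → Prop
  | beta_pair (i a₁ a₂) : Step (proj i (pair a₁ a₂)) (i.pick a₁ a₂)
  | beta_case (i a b₁ b₂) : Step (case (inj i a) b₁ b₂) ((i.pick b₁ b₂).inst a)
  | beta_lam (a b) : Step (app (lam a) b) (a.inst b)
  | beta_copair (a₁ a₂ b) : Step (colam (copair a₁ a₂) b) (b.inst₂ a₁ a₂)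
  | beta_neg (a) : Step (nege (negi a)) a
  | beta_tlam (a) : Step (tapp (tlam a)) a
  | beta_pack (a b) : Step (opn (pack a) b) (b.inst a)
  | abs_pair_inj (a₁ a₂ i b) : Step (abs (pair a₁ a₂) (inj i b)) (gabs (i.pick a₁ a₂) b)
  | abs_inj_pair (i a b₁ b₂) : Step (abs (inj i a) (pair b₁ b₂)) (gabs a (i.pick b₁ b₂))
  | abs_lam_copair (a b c) : Step (abs (lam a) (copair b c)) (gabs (a.inst b) c)
  | abs_copair_lam (a b c) : Step (abs (copair a b) (lam c)) (gabs b (c.inst a))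
  | abs_neg (a b) : Step (abs (negi a) (negi b)) (gabs b a)
  | abs_tlam_pack (a b) : Step (abs (tlam a) (pack b)) (gabs a b)
  | abs_pack_tlam (a b) : Step (abs (pack a) (tlam b)) (gabs a b)
  | abs₁ {a a'} (b) : Step a a' → Step (abs a b) (abs a' b)
  | abs₂ {b b'} (a) : Step b b' → Step (abs a b) (abs a b')
  | pair₁ {a a'} (b) : Step a a' → Step (pair a b) (pair a' b)
  | pair₂ {b b'} (a) : Step b b' → Step (pair a b) (pair a b')
  | proj {a a'} (i) : Step a a' → Step (proj i a) (proj i a')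
  | inj {a a'} (i) : Step a a' → Step (inj i a) (inj i a')
  | case₁ {a a'} (b c) : Step a a' → Step (case a b c) (case a' b c)
  | case₂ {b b'} (a c) : Step b b' → Step (case a b c) (case a b' c)
  | case₃ {c c'} (a b) : Step c c' → Step (case a b c) (case a b c')
  | lam {a a'} : Step a a' → Step (lam a) (lam a')
  | app₁ {a a'} (b) : Step a a' → Step (app a b) (app a' b)
  | app₂ {b b'} (a) : Step b b' → Step (app a b) (app a b')
  | copair₁ {a a'} (b) : Step a a' → Step (copair a b) (copair a' b)
  | copair₂ {b b'} (a) : Step b b' → Step (copair a b) (copair a b')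
  | colam₁ {a a'} (b) : Step a a' → Step (colam a b) (colam a' b)
  | colam₂ {b b'} (a) : Step b b' → Step (colam a b) (colam a b')
  | negi {a a'} : Step a a' → Step (negi a) (negi a')
  | nege {a a'} : Step a a' → Step (nege a) (nege a')
  | tlam {a a'} : Step a a' → Step (tlam a) (tlam a')
  | tapp {a a'} : Step a a' → Step (tapp a) (tapp a')
  | pack {a a'} : Step a a' → Step (pack a) (pack a')
  | opn₁ {a a'} (b) : Step a a' → Step (opn a b) (opn a' b)
  | opn₂ {b b'} (a) : Step b b' → Step (opn a b) (opn a b')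

/-- Many-step reduction. -/
def Red : UTm → UTm → Prop := Relation.ReflTransGen Step

/-- Strong normalization: every reduction sequence from the term is finite. -/
def SN (a : UTm) : Prop := Acc (fun b' b => Step b b') a

/-- Canonical terms: those built with a constructor. -/
inductive Can : UTm → Prop
  | pair (a b) : Can (pair a b)
  | inj (i a) : Can (inj i a)
  | lam (a) : Can (lam a)
  | copair (a b) : Can (copair a b)
  | negi (a) : Can (negi a)
  | tlam (a) : Can (tlam a)
  | pack (a) : Can (pack a)

end UTm

/-- Type erasure; the weak abstraction and application become the ordinary ones. -/
def Tm.erase : Tm → UTm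
  | .var x _ => .var x
  | .abs _ t s => .abs t.erase s.erase
  | .wlam _ _ t => .lam t.erase
  | .wapp _ t s => .app t.erase s.erase
  | .pair _ t s => .pair t.erase s.erase
  | .proj _ i t => .proj i t.erase
  | .inj _ i t => .inj i t.erase
  | .case _ t _ u _ v => .case t.erase u.erase v.erase
  | .lam _ _ t => .lam t.erase
  | .app _ t s => .app t.erase s.erase
  | .copair _ t s => .copair t.erase s.erase
  | .colam _ t _ _ u => .colam t.erase u.erase
  | .negi _ t => .negi t.erase
  | .nege _ t => .nege t.erase
  | .tlam _ t => .tlam t.erase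
  | .tapp _ t _ => .tapp t.erase
  | .pack _ _ t => .pack t.erase
  | .opn _ t _ u => .opn t.erase u.erase

/-! ### Reducibility candidates -/

/-- A set of strongly normalizing untyped terms is a reducibility candidate if it is closed by
reduction and complete. -/
structure IsRC (ξ : Set UTm) : Prop where
  sn : ∀ a ∈ ξ, a.SN
  closed : ∀ a b, a ∈ ξ → UTm.Step a b → b ∈ ξ
  complete : ∀ a, a.SN → (∀ b, UTm.Can b → UTm.Red a b → b ∈ ξ) → a ∈ ξ

theorem IsRC.red {ξ : Set UTm} (h : IsRC ξ) {a b : UTm} (hab : UTm.Red a b) (ha : a ∈ ξ) :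
    b ∈ ξ := by
  induction hab with
  | refl => exact ha
  | tail _ hs ih => exact h.closed _ _ ih hs

/-- The type of reducibility candidates, ordered by inclusion. -/
abbrev RC := {ξ : Set UTm // IsRC ξ}

namespace RC

/-- The greatest lower bound of a set of candidates, the intersection. -/
def inf (S : Set RC) : RC where
  val := {a | a.SN ∧ ∀ ξ ∈ S, a ∈ ξ.1}
  property :=
    { sn := fun _ ha => ha.1
      closed := fun _ _ ha hab =>
        ⟨ha.1.inv hab, fun ξ hξ => ξ.2.closed _ _ (ha.2 ξ hξ) hab⟩
      complete := fun a hsn h =>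
        ⟨hsn, fun ξ hξ => ξ.2.complete a hsn fun b hb hab => (h b hb hab).2 ξ hξ⟩ }

instance : InfSet RC := ⟨inf⟩

/-- The complete lattice of reducibility candidates, ordered by inclusion. -/
instance : CompleteLattice RC :=
  completeLatticeOfInf RC fun _ =>
    ⟨fun ξ hξ _ ha => ha.2 ξ hξ,
      fun ξ hξ a ha => ⟨ξ.2.sn a ha, fun _ hζ => hξ hζ ha⟩⟩

/-- The closure of a set of canonical terms: the strongly normalizing terms all of whose canonical
reducts are in the set. -/
def closure (X : Set UTm) : RC where
  val := {a | a.SN ∧ ∀ b, UTm.Can b → UTm.Red a b → b ∈ X}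
  property :=
    { sn := fun _ ha => ha.1
      closed := fun _ _ ha hab =>
        ⟨ha.1.inv hab, fun c hc hbc => ha.2 c hc (Relation.ReflTransGen.head hab hbc)⟩
      complete := fun _ hsn h =>
        ⟨hsn, fun b hb hab => (h b hb hab).2 b hb Relation.ReflTransGen.refl⟩ }

def prod (ξ₁ ξ₂ : RC) : RC :=
  closure {c | ∃ a₁ ∈ ξ₁.1, ∃ a₂ ∈ ξ₂.1, c = UTm.pair a₁ a₂}

def sum (ξ₁ ξ₂ : RC) : RC :=
  closure {c | ∃ i : Idx, ∃ a ∈ (i.pick ξ₁ ξ₂).1, c = UTm.inj i a}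

theorem red_app_can {a c b : UTm} (h : UTm.Red (.app a c) b) (hb : UTm.Can b) :
    ∃ a' c', UTm.Red a (.lam a') ∧ UTm.Red c c' ∧ UTm.Red (a'.inst c') b := by
  generalize hd : UTm.app a c = d at h
  induction h using Relation.ReflTransGen.head_induction_on generalizing a c with
  | refl => subst hd; cases hb
  | head hs hr ih =>
    subst hd
    cases hs with
    | beta_lam a' _ => exact ⟨a', c, .refl, .refl, hr⟩
    | app₁ _ hs =>
      obtain ⟨a', c', h1, h2, h3⟩ := ih rfl
      exact ⟨a', c', .head hs h1, h2, h3⟩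
    | app₂ _ hs =>
      obtain ⟨a', c', h1, h2, h3⟩ := ih rfl
      exact ⟨a', c', h1, .head hs h2, h3⟩

theorem sn_app {a c : UTm} (ha : a.SN) (hc : c.SN)
    (h : ∀ a' c', UTm.Red a (.lam a') → UTm.Red c c' → (UTm.app (.lam a') c').SN) :
    (UTm.app a c).SN := by
  induction ha generalizing c with
  | intro a ha iha =>
    induction hc with
    | intro c hc ihc =>
      refine Acc.intro _ fun d hd => ?_
      cases hd with
      | beta_lam a' _ => exact (h a' c .refl .refl).inv (.beta_lam _ _)
      | app₁ _ hs =>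
        exact iha _ hs (Acc.intro _ hc) fun a' c' h1 h2 => h a' c' (.head hs h1) h2
      | app₂ _ hs => exact ihc _ hs fun a' c' h1 h2 => h a' c' h1 (.head hs h2)

def arrow (ξ₁ ξ₂ : RC) : RC where
  val := {a | a.SN ∧ ∀ b ∈ ξ₁.1, UTm.app a b ∈ ξ₂.1}
  property :=
    { sn := fun _ ha => ha.1
      closed := fun _ _ ha hab =>
        ⟨ha.1.inv hab, fun c hc => ξ₂.2.closed _ _ (ha.2 c hc) (.app₁ _ hab)⟩
      complete := fun a hsn h => by
        refine ⟨hsn, fun c hc => ?_⟩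
        have key : ∀ a' c', UTm.Red a (.lam a') → UTm.Red c c' →
            UTm.app (.lam a') c' ∈ ξ₂.1 := fun a' c' h1 h2 =>
          (h _ (.lam a') h1).2 c' (ξ₁.2.red h2 hc)
        refine ξ₂.2.complete _ (sn_app hsn (ξ₁.2.sn c hc) fun a' c' h1 h2 =>
          ξ₂.2.sn _ (key a' c' h1 h2)) fun b hb hab => ?_
        obtain ⟨a', c', h1, h2, h3⟩ := red_app_can hab hb
        exact ξ₂.2.red (.head (.beta_lam _ _) h3) (key a' c' h1 h2) }

def coarrow (ξ₁ ξ₂ : RC) : RC :=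
  closure {c | ∃ a₁ ∈ ξ₁.1, ∃ a₂ ∈ ξ₂.1, c = UTm.copair a₁ a₂}

def neg (ξ : RC) : RC :=
  closure {c | ∃ a ∈ ξ.1, c = UTm.negi a}

theorem red_tapp_can {a b : UTm} (h : UTm.Red (.tapp a) b) (hb : UTm.Can b) :
    ∃ a', UTm.Red a (.tlam a') ∧ UTm.Red a' b := by
  generalize hd : UTm.tapp a = d at h
  induction h using Relation.ReflTransGen.head_induction_on generalizing a with
  | refl => subst hd; cases hb
  | head hs hr ih =>
    subst hd
    cases hs with
    | beta_tlam => exact ⟨_, .refl, hr⟩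
    | tapp hs =>
      obtain ⟨a', h1, h2⟩ := ih rfl
      exact ⟨a', .head hs h1, h2⟩

theorem sn_tapp {a : UTm} (ha : a.SN)
    (h : ∀ a', UTm.Red a (.tlam a') → (UTm.tapp (.tlam a')).SN) : (UTm.tapp a).SN := by
  induction ha with
  | intro a ha iha =>
    refine Acc.intro _ fun d hd => ?_
    cases hd with
    | beta_tlam => exact (h _ .refl).inv (.beta_tlam _)
    | tapp hs => exact iha _ hs fun a' h1 => h a' (.head hs h1)

/-- The indexed product of a family of candidates. -/
def all {ι : Type*} (ξ : ι → RC) : RC where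
  val := {a | a.SN ∧ ∀ i, UTm.tapp a ∈ (ξ i).1}
  property :=
    { sn := fun _ ha => ha.1
      closed := fun _ _ ha hab =>
        ⟨ha.1.inv hab, fun i => (ξ i).2.closed _ _ (ha.2 i) (.tapp hab)⟩
      complete := fun a hsn h => by
        refine ⟨hsn, fun i => ?_⟩
        have key : ∀ a', UTm.Red a (.tlam a') → UTm.tapp (.tlam a') ∈ (ξ i).1 :=
          fun a' h1 => (h _ (.tlam a') h1).2 i
        refine (ξ i).2.complete _ (sn_tapp hsn fun a' h1 => (ξ i).2.sn _ (key a' h1))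
          fun b hb hab => ?_
        obtain ⟨a', h1, h2⟩ := red_tapp_can hab hb
        exact (ξ i).2.red (.head (.beta_tlam _) h2) (key a' h1) }

/-- The indexed sum of a family of candidates. -/
def ex {ι : Type*} (ξ : ι → RC) : RC :=
  closure {c | ∃ a, (∃ i, a ∈ (ξ i).1) ∧ c = UTm.pack a}

/-- Two candidates are orthogonal if the absurdity of any two of their elements is strongly
normalizing. -/
def Orthogonal (ξ₁ ξ₂ : RC) : Prop := ∀ a₁ ∈ ξ₁.1, ∀ a₂ ∈ ξ₂.1, (UTm.abs a₁ a₂).SN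

theorem arrow_anti {ξ₁ ξ₁' : RC} (h : ξ₁ ≤ ξ₁') (ξ₂ : RC) : arrow ξ₁' ξ₂ ≤ arrow ξ₁ ξ₂ :=
  fun _ ha => ⟨ha.1, fun b hb => ha.2 b (h hb)⟩

/-- The order-preserving map `ξ ↦ ((ξ → ζ₁) → ζ₂)`. -/
def arrowArrow (ζ₁ ζ₂ : RC) : RC →o RC where
  toFun ξ := arrow (arrow ξ ζ₁) ζ₂
  monotone' := fun _ _ h => arrow_anti (arrow_anti h ζ₁) ζ₂

end RC

/-- The set of all orthogonal pairs of candidates. -/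
abbrev OrthPair := {p : RC × RC // RC.Orthogonal p.1 p.2}

/-- Environments: every type variable is mapped to an orthogonal pair, formed by the candidate
for its strong affirmation and the candidate for its strong denial. -/
abbrev Env := ℕ → OrthPair

/-- The environment `ρ[α := p]`, where `α` is a new type variable, with index `0`. -/
def Env.cons (p : OrthPair) (ρ : Env) : Env
  | 0 => p
  | n + 1 => ρ n

/-- The reducible terms of a type under an environment. -/
def reducible : Ty → Env → RC
  | .pos (.var n), ρ => (ρ n).1.1
  | .neg (.var n), ρ => (ρ n).1.2
  | .pos (.and A B), ρ => (reducible (.wpos A) ρ).prod (reducible (.wpos B) ρ)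
  | .neg (.and A B), ρ => (reducible (.wneg A) ρ).sum (reducible (.wneg B) ρ)
  | .pos (.or A B), ρ => (reducible (.wpos A) ρ).sum (reducible (.wpos B) ρ)
  | .neg (.or A B), ρ => (reducible (.wneg A) ρ).prod (reducible (.wneg B) ρ)
  | .pos (.imp A B), ρ => (reducible (.wpos A) ρ).arrow (reducible (.wpos B) ρ)
  | .neg (.imp A B), ρ => (reducible (.wpos A) ρ).coarrow (reducible (.wneg B) ρ)
  | .pos (.coimp A B), ρ => (reducible (.wneg A) ρ).coarrow (reducible (.wpos B) ρ)
  | .neg (.coimp A B), ρ => (reducible (.wneg A) ρ).arrow (reducible (.wneg B) ρ)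
  | .pos (.neg A), ρ => (reducible (.wneg A) ρ).neg
  | .neg (.neg A), ρ => (reducible (.wpos A) ρ).neg
  | .pos (.all A), ρ => RC.all fun p : OrthPair => reducible (.wpos A) (Env.cons p ρ)
  | .neg (.all A), ρ => RC.ex fun p : OrthPair => reducible (.wneg A) (Env.cons p ρ)
  | .pos (.ex A), ρ => RC.ex fun p : OrthPair => reducible (.wpos A) (Env.cons p ρ)
  | .neg (.ex A), ρ => RC.all fun p : OrthPair => reducible (.wneg A) (Env.cons p ρ)
  | .wpos A, ρ =>
      OrderHom.lfp (RC.arrowArrow (reducible (.neg A) ρ) (reducible (.pos A) ρ))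
  | .wneg A, ρ =>
      OrderHom.gfp (RC.arrowArrow (reducible (.pos A) ρ) (reducible (.neg A) ρ))
termination_by P => P.measure
decreasing_by all_goals simp only [Ty.measure, PureTy.size]; omega

/-- The substitution `σ` is adequate for the context `Γ` under the environment `ρ`. -/
def Adequate (σ : ℕ → UTm) (ρ : Env) (Γ : Ctx) : Prop :=
  ∀ x P, Γ.get x = some P → σ x ∈ (reducible P ρ).1

end PRK

/-!
Reducibility candidates for second-order `λ^PRK`.

Erasure maps every reduction step to exactly one step of untyped terms, so strong normalization
follows from adequacy applied to the identity substitution: every candidate contains the variables,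
and consists of strongly normalizing terms.

Adequacy is proved by induction on typing. For the eliminators the tool is
`RC.mem_of_steps`: a term that is not canonical belongs to a candidate as soon as all its one-step
reducts do. Two facts are specific to this calculus.

* The least fixed point that interprets `A^⊕` and the greatest one that interprets `A^⊖` determine
  each other: `[[A^⊕]] = [[A^⊖]] → [[A^+]]` and `[[A^⊖]] = [[A^⊕]] → [[A^-]]`
  (`reducible_wpos`, `reducible_wneg`). Writing `N` and `P` for the candidates of `A^-` and `A^+`, if
  `μ` is the least fixed point of `ξ ↦ ((ξ → N) → P)` then `μ → N` is a fixed point of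
  `ξ ↦ ((ξ → P) → N)`, and it is the greatest, because `ξ ≤ ((ξ → P) → N)` makes `ξ → P` a pre-fixed
  point of the first map, hence an upper bound of `μ`. These equations account for the
  introduction and elimination of the weak types.
* The candidates of `A^+` and `A^-` are orthogonal (`orthogonal_pos_neg`), by induction on `A`.
  An absurdity reduces at its root to a generalized absurdity between elements of the weak candidates
  of a component, and the two equations above reduce that to the induction hypothesis. The case
  of a type variable is the orthogonality of the environment. Orthogonality is used a second time
  for the quantifiers, which range over orthogonal pairs only: it is what allows the candidates of
  an arbitrary type to instantiate them (`reducible_subst`).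
-/

namespace PRK

/-! ### Substitution in untyped terms -/

namespace UTm

theorem up_var (f : ℕ → ℕ) : up (fun x => var (f x)) = fun x => var (upRen f x) := by
  funext x
  cases x <;> rfl

theorem rename_eq_subst (a : UTm) (f : ℕ → ℕ) : a.rename f = a.subst fun x => var (f x) := by
  induction a generalizing f <;> simp_all [rename, subst, up_var]

theorem up_comp_upRen (σ : ℕ → UTm) (f : ℕ → ℕ) :
    (fun x => up σ (upRen f x)) = up fun x => σ (f x) := by
  funext x
  cases x <;> rfl

theorem subst_rename (a : UTm) (f : ℕ → ℕ) (σ : ℕ → UTm) :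
    (a.rename f).subst σ = a.subst fun x => σ (f x) := by
  induction a generalizing f σ <;> simp_all [rename, subst, up_comp_upRen]

theorem rename_rename (a : UTm) (f g : ℕ → ℕ) :
    (a.rename f).rename g = a.rename fun x => g (f x) := by
  rw [rename_eq_subst _ g, subst_rename, ← rename_eq_subst a fun x => g (f x)]

theorem rename_up (σ : ℕ → UTm) (f : ℕ → ℕ) :
    (fun x => (up σ x).rename (upRen f)) = up fun x => (σ x).rename f := by
  funext x
  cases x with
  | zero => rfl
  | succ x =>
    change ((σ x).rename Nat.succ).rename (upRen f) = ((σ x).rename f).rename Nat.succ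
    rw [rename_rename, rename_rename]
    rfl

theorem rename_subst (a : UTm) (σ : ℕ → UTm) (f : ℕ → ℕ) :
    (a.subst σ).rename f = a.subst fun x => (σ x).rename f := by
  induction a generalizing f σ <;> simp_all [rename, subst, rename_up]

theorem subst_up (σ τ : ℕ → UTm) :
    (fun x => (up σ x).subst (up τ)) = up fun x => (σ x).subst τ := by
  funext x
  cases x with
  | zero => rfl
  | succ x =>
    change ((σ x).rename Nat.succ).subst (up τ) = ((σ x).subst τ).rename Nat.succ
    rw [subst_rename, rename_subst]
    rfl

theorem subst_subst (a : UTm) (σ τ : ℕ → UTm) :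
    (a.subst σ).subst τ = a.subst fun x => (σ x).subst τ := by
  induction a generalizing σ τ <;> simp_all [subst, subst_up]

theorem subst_var (a : UTm) : a.subst var = a := by
  have h : up var = var := up_var id |>.trans (by funext x; cases x <;> rfl)
  induction a <;> simp_all [subst]

theorem rename_succ_subst_scons (a b : UTm) (σ : ℕ → UTm) :
    (a.rename Nat.succ).subst (scons b σ) = a.subst σ :=
  subst_rename a _ _

theorem inst_subst_up (a b : UTm) (σ : ℕ → UTm) :
    (a.subst (up σ)).inst b = a.subst (scons b σ) := by
  rw [inst, subst_subst]
  congr 1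
  funext x
  cases x with
  | zero => rfl
  | succ x => exact (rename_succ_subst_scons _ _ _).trans (subst_var _)

theorem inst₂_subst_up_up (a b c : UTm) (σ : ℕ → UTm) :
    (a.subst (up (up σ))).inst₂ b c = a.subst (scons c (scons b σ)) := by
  rw [inst₂, subst_subst]
  congr 1
  funext x
  obtain _ | _ | x := x
  · rfl
  · rfl
  · change (((σ x).rename Nat.succ).rename Nat.succ).subst _ = σ x
    rw [rename_succ_subst_scons, rename_succ_subst_scons, subst_var]

theorem subst_inst (a b : UTm) (σ : ℕ → UTm) :
    (a.inst b).subst σ = (a.subst (up σ)).inst (b.subst σ) := by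
  rw [inst_subst_up, inst, subst_subst]
  congr 1
  funext x
  cases x <;> rfl

theorem subst_inst₂ (a b c : UTm) (σ : ℕ → UTm) :
    (a.inst₂ b c).subst σ = (a.subst (up (up σ))).inst₂ (b.subst σ) (c.subst σ) := by
  rw [inst₂_subst_up_up, inst₂, subst_subst]
  congr 1
  funext x
  obtain _ | _ | x := x <;> rfl

theorem subst_pick (i : Idx) (a b : UTm) (σ : ℕ → UTm) :
    (i.pick a b).subst σ = i.pick (a.subst σ) (b.subst σ) := by
  cases i <;> rfl

theorem Step.subst {a b : UTm} (h : Step a b) (σ : ℕ → UTm) :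
    Step (a.subst σ) (b.subst σ) := by
  induction h generalizing σ <;>
    simp only [UTm.subst, gabs, subst_pick, subst_inst, subst_inst₂] <;>
    first
    | (constructor; done)
    | (constructor; apply_assumption)

/-- Strong normalization is reflected by substitution, because reduction is preserved by it. -/
theorem SN.of_subst {a : UTm} {σ : ℕ → UTm} (h : (a.subst σ).SN) : a.SN :=
  Subrelation.accessible (fun hs => Step.subst hs σ)
    (InvImage.accessible (fun a : UTm => a.subst σ) h)

/-! ### Strong normalization of canonical terms -/

theorem SN.unary {c : UTm → UTm} (hc : ∀ a b, Step (c a) b → ∃ a', Step a a' ∧ b = c a')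
    {a : UTm} (ha : a.SN) : (c a).SN := by
  induction ha with
  | intro a _ ih =>
    refine Acc.intro _ fun b hb => ?_
    obtain ⟨a', h, rfl⟩ := hc _ _ hb
    exact ih _ h

theorem SN.binary {c : UTm → UTm → UTm}
    (hc : ∀ a b d, Step (c a b) d →
      (∃ a', Step a a' ∧ d = c a' b) ∨ ∃ b', Step b b' ∧ d = c a b')
    {a b : UTm} (ha : a.SN) (hb : b.SN) : (c a b).SN := by
  induction ha generalizing b with
  | intro a _ iha =>
    induction hb with
    | intro b hb ihb =>
      refine Acc.intro _ fun d hd => ?_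
      obtain ⟨a', h, rfl⟩ | ⟨b', h, rfl⟩ := hc _ _ _ hd
      · exact iha _ h (Acc.intro _ hb)
      · exact ihb _ h

theorem SN.pair {a b : UTm} (ha : a.SN) (hb : b.SN) : (pair a b).SN :=
  .binary (fun _ _ _ h => by cases h <;> simp_all) ha hb

theorem SN.copair {a b : UTm} (ha : a.SN) (hb : b.SN) : (copair a b).SN :=
  .binary (fun _ _ _ h => by cases h <;> simp_all) ha hb

theorem SN.inj (i : Idx) {a : UTm} (ha : a.SN) : (inj i a).SN :=
  .unary (fun _ _ h => by cases h; simp_all) ha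

theorem SN.lam {a : UTm} (ha : a.SN) : (lam a).SN :=
  .unary (fun _ _ h => by cases h; simp_all) ha

theorem SN.negi {a : UTm} (ha : a.SN) : (negi a).SN :=
  .unary (fun _ _ h => by cases h; simp_all) ha

theorem SN.tlam {a : UTm} (ha : a.SN) : (tlam a).SN :=
  .unary (fun _ _ h => by cases h; simp_all) ha

theorem SN.pack {a : UTm} (ha : a.SN) : (pack a).SN :=
  .unary (fun _ _ h => by cases h; simp_all) ha

end UTm

/-! ### Introduction and elimination for the operations on candidates -/

namespace RC

open UTm

/-- A term that is not canonical belongs to a candidate as soon as all its one-step reducts do. -/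
theorem mem_of_steps (ξ : RC) {a : UTm} (hc : ¬ Can a) (h : ∀ b, Step a b → b ∈ ξ.1) :
    a ∈ ξ.1 := by
  refine ξ.2.complete a (Acc.intro _ fun b hb => ξ.2.sn b (h b hb)) fun b hb hab => ?_
  obtain rfl | ⟨c, hac, hcb⟩ := hab.cases_head
  · exact absurd hb hc
  · exact ξ.2.red hcb (h c hac)

theorem var_mem (ξ : RC) (x : ℕ) : var x ∈ ξ.1 :=
  mem_of_steps ξ (by rintro ⟨⟩) (by rintro _ ⟨⟩)

theorem sn_of_inst_mem {ξ ζ : RC} {a : UTm} (h : ∀ b ∈ ξ.1, a.inst b ∈ ζ.1) : a.SN :=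
  SN.of_subst (ζ.2.sn _ (h _ (ξ.var_mem 0)))

theorem sn_of_inst₂_mem {ξ₁ ξ₂ ζ : RC} {a : UTm}
    (h : ∀ b ∈ ξ₁.1, ∀ c ∈ ξ₂.1, a.inst₂ b c ∈ ζ.1) : a.SN :=
  SN.of_subst (ζ.2.sn _ (h _ (ξ₁.var_mem 0) _ (ξ₂.var_mem 0)))

theorem mem_closure {X : Set UTm} (hX : ∀ a b, a ∈ X → Step a b → b ∈ X) {a : UTm} (ha : a ∈ X)
    (hsn : a.SN) : a ∈ (closure X).1 := by
  refine ⟨hsn, fun b hb hab => ?_⟩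
  -- The intermediate terms of the reduction need not be canonical.
  clear hb
  induction hab with
  | refl => exact ha
  | tail _ hs ih => exact hX _ _ ih hs

theorem mem_of_mem_closure {X : Set UTm} {a : UTm} (ha : a ∈ (closure X).1) (hc : Can a) :
    a ∈ X :=
  ha.2 a hc .refl

variable {ξ ξ₁ ξ₂ ζ ζ₁ ζ₂ : RC} {a b c : UTm}

theorem pair_mem_prod (ha : a ∈ ξ₁.1) (hb : b ∈ ξ₂.1) : UTm.pair a b ∈ (prod ξ₁ ξ₂).1 := by
  refine mem_closure ?_ ⟨a, ha, b, hb, rfl⟩ ((ξ₁.2.sn a ha).pair (ξ₂.2.sn b hb))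
  rintro _ _ ⟨a, ha, b, hb, rfl⟩ (_ | _)
  · exact ⟨_, ξ₁.2.closed _ _ ha ‹_›, _, hb, rfl⟩
  · exact ⟨_, ha, _, ξ₂.2.closed _ _ hb ‹_›, rfl⟩

theorem copair_mem_coarrow (ha : a ∈ ξ₁.1) (hb : b ∈ ξ₂.1) :
    UTm.copair a b ∈ (coarrow ξ₁ ξ₂).1 := by
  refine mem_closure ?_ ⟨a, ha, b, hb, rfl⟩ ((ξ₁.2.sn a ha).copair (ξ₂.2.sn b hb))
  rintro _ _ ⟨a, ha, b, hb, rfl⟩ (_ | _)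
  · exact ⟨_, ξ₁.2.closed _ _ ha ‹_›, _, hb, rfl⟩
  · exact ⟨_, ha, _, ξ₂.2.closed _ _ hb ‹_›, rfl⟩

theorem inj_mem_sum (i : Idx) (ha : a ∈ (i.pick ξ₁ ξ₂).1) : UTm.inj i a ∈ (sum ξ₁ ξ₂).1 := by
  refine mem_closure ?_ ⟨i, a, ha, rfl⟩ (((i.pick ξ₁ ξ₂).2.sn a ha).inj i)
  rintro _ _ ⟨i, a, ha, rfl⟩ (_ | _)
  exact ⟨i, _, (i.pick ξ₁ ξ₂).2.closed _ _ ha ‹_›, rfl⟩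

theorem negi_mem_neg (ha : a ∈ ξ.1) : UTm.negi a ∈ (neg ξ).1 := by
  refine mem_closure ?_ ⟨a, ha, rfl⟩ (ξ.2.sn a ha).negi
  rintro _ _ ⟨a, ha, rfl⟩ (_ | _)
  exact ⟨_, ξ.2.closed _ _ ha ‹_›, rfl⟩

theorem pack_mem_ex {ι : Type*} {ξ : ι → RC} (i : ι) (ha : a ∈ (ξ i).1) :
    UTm.pack a ∈ (ex ξ).1 := by
  refine mem_closure ?_ ⟨a, ⟨i, ha⟩, rfl⟩ ((ξ i).2.sn a ha).pack
  rintro _ _ ⟨a, ⟨i, ha⟩, rfl⟩ (_ | _)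
  exact ⟨_, ⟨i, (ξ i).2.closed _ _ ha ‹_›⟩, rfl⟩

theorem lam_mem_arrow (h : ∀ b ∈ ξ.1, a.inst b ∈ ζ.1) : UTm.lam a ∈ (arrow ξ ζ).1 := by
  have ha := sn_of_inst_mem h
  refine ⟨ha.lam, fun b hb => ?_⟩
  induction ha generalizing b with
  | intro a _ iha =>
    induction ξ.2.sn b hb with
    | intro b _ ihb =>
      refine mem_of_steps ζ (by rintro ⟨⟩) ?_
      rintro _ (_ | _)
      · exact h b hb
      · rename_i hs
        cases hs with
        | lam hs => exact iha _ hs (fun b hb => ζ.2.closed _ _ (h b hb) (hs.subst _)) b hb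
      · exact ihb _ ‹_› (ξ.2.closed _ _ hb ‹_›)

theorem tlam_mem_all {ι : Type*} [Nonempty ι] {ξ : ι → RC} (h : ∀ i, a ∈ (ξ i).1) :
    UTm.tlam a ∈ (all ξ).1 := by
  have ha : a.SN := (ξ (Classical.arbitrary ι)).2.sn _ (h _)
  refine ⟨ha.tlam, fun i => ?_⟩
  replace h := h i
  induction ha with
  | intro a _ ih =>
    refine mem_of_steps (ξ i) (by rintro ⟨⟩) ?_
    rintro _ (_ | _)
    · exact h
    · rename_i hs
      cases hs with
      | tlam hs => exact ih _ hs ((ξ i).2.closed _ _ h hs)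

theorem proj_mem (i : Idx) (ha : a ∈ (prod ξ₁ ξ₂).1) :
    UTm.proj i a ∈ (i.pick ξ₁ ξ₂).1 := by
  induction (prod ξ₁ ξ₂).2.sn a ha with
  | intro a _ ih =>
    refine mem_of_steps _ (by rintro ⟨⟩) ?_
    rintro _ (_ | _)
    · obtain ⟨_, h₁, _, h₂, ⟨⟩⟩ := mem_of_mem_closure ha (.pair _ _)
      cases i
      exacts [h₁, h₂]
    · exact ih _ ‹_› ((prod ξ₁ ξ₂).2.closed _ _ ha ‹_›)

theorem nege_mem (ha : a ∈ (neg ξ).1) : UTm.nege a ∈ ξ.1 := by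
  induction (neg ξ).2.sn a ha with
  | intro a _ ih =>
    refine mem_of_steps _ (by rintro ⟨⟩) ?_
    rintro _ (_ | _)
    · obtain ⟨_, h, ⟨⟩⟩ := mem_of_mem_closure ha (.negi _)
      exact h
    · exact ih _ ‹_› ((neg ξ).2.closed _ _ ha ‹_›)

theorem case_mem (ha : a ∈ (sum ξ₁ ξ₂).1) (hb : ∀ d ∈ ξ₁.1, b.inst d ∈ ζ.1)
    (hc : ∀ d ∈ ξ₂.1, c.inst d ∈ ζ.1) : UTm.case a b c ∈ ζ.1 := by
  induction (sum ξ₁ ξ₂).2.sn a ha generalizing b c with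
  | intro a _ iha =>
    induction sn_of_inst_mem hb generalizing c with
    | intro b _ ihb =>
      induction sn_of_inst_mem hc with
      | intro c _ ihc =>
        refine mem_of_steps _ (by rintro ⟨⟩) ?_
        rintro _ (_ | _)
        · obtain ⟨_ | _, _, h, ⟨⟩⟩ := mem_of_mem_closure ha (.inj _ _)
          exacts [hb _ h, hc _ h]
        · exact iha _ ‹_› ((sum ξ₁ ξ₂).2.closed _ _ ha ‹_›) hb hc
        · exact ihb _ ‹_› (fun d hd => ζ.2.closed _ _ (hb d hd) (Step.subst ‹_› _)) hc
        · exact ihc _ ‹_› (fun d hd => ζ.2.closed _ _ (hc d hd) (Step.subst ‹_› _))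

theorem colam_mem (ha : a ∈ (coarrow ξ₁ ξ₂).1)
    (hb : ∀ d ∈ ξ₁.1, ∀ e ∈ ξ₂.1, b.inst₂ d e ∈ ζ.1) : UTm.colam a b ∈ ζ.1 := by
  induction (coarrow ξ₁ ξ₂).2.sn a ha generalizing b with
  | intro a _ iha =>
    induction sn_of_inst₂_mem hb with
    | intro b _ ihb =>
      refine mem_of_steps _ (by rintro ⟨⟩) ?_
      rintro _ (_ | _)
      · obtain ⟨_, h₁, _, h₂, ⟨⟩⟩ := mem_of_mem_closure ha (.copair _ _)
        exact hb _ h₁ _ h₂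
      · exact iha _ ‹_› ((coarrow ξ₁ ξ₂).2.closed _ _ ha ‹_›) hb
      · exact ihb _ ‹_› (fun d hd e he => ζ.2.closed _ _ (hb d hd e he) (Step.subst ‹_› _))

theorem opn_mem {ι : Type*} [Nonempty ι] {ξ : ι → RC} (ha : a ∈ (ex ξ).1)
    (hb : ∀ i, ∀ d ∈ (ξ i).1, b.inst d ∈ ζ.1) : UTm.opn a b ∈ ζ.1 := by
  induction (ex ξ).2.sn a ha generalizing b with
  | intro a _ iha =>
    induction sn_of_inst_mem (hb (Classical.arbitrary ι)) with
    | intro b _ ihb =>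
      refine mem_of_steps _ (by rintro ⟨⟩) ?_
      rintro _ (_ | _)
      · obtain ⟨_, ⟨i, h⟩, ⟨⟩⟩ := mem_of_mem_closure ha (.pack _)
        exact hb i _ h
      · exact iha _ ‹_› ((ex ξ).2.closed _ _ ha ‹_›) hb
      · exact ihb _ ‹_› (fun i d hd => ζ.2.closed _ _ (hb i d hd) (Step.subst ‹_› _))

theorem red_abs_not_can (h : Red (.abs a b) c) : ¬ Can c := by
  have key : ∃ a' b', c = .abs a' b' := by
    induction h with
    | refl => exact ⟨_, _, rfl⟩
    | tail _ hs ih =>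
      obtain ⟨_, _, rfl⟩ := ih
      cases hs <;> exact ⟨_, _, rfl⟩
  obtain ⟨_, _, rfl⟩ := key
  rintro ⟨⟩

/-- Absurdities never reduce to canonical terms, so every candidate contains the strongly
normalizing ones. -/
theorem abs_mem (ξ : RC) (h : (UTm.abs a b).SN) : UTm.abs a b ∈ ξ.1 :=
  ξ.2.complete _ h fun _ hc hr => absurd hc (red_abs_not_can hr)

/-! ### The fixed points that interpret the weak types -/

theorem arrow_lfp (ζ₁ ζ₂ : RC) :
    arrow (arrow (arrowArrow ζ₁ ζ₂).lfp ζ₁) ζ₂ = (arrowArrow ζ₁ ζ₂).lfp :=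
  (arrowArrow ζ₁ ζ₂).map_lfp

theorem gfp_arrowArrow (ζ₁ ζ₂ : RC) :
    (arrowArrow ζ₂ ζ₁).gfp = arrow (arrowArrow ζ₁ ζ₂).lfp ζ₁ := by
  refine le_antisymm ((arrowArrow ζ₂ ζ₁).gfp_le fun ξ hξ => ?_)
    ((arrowArrow ζ₂ ζ₁).le_gfp (le_of_eq ?_))
  · exact hξ.trans (arrow_anti ((arrowArrow ζ₁ ζ₂).lfp_le (arrow_anti hξ ζ₂)) ζ₁)
  · exact congrArg (fun ξ => arrow ξ ζ₁) (arrow_lfp ζ₁ ζ₂).symm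

/-! ### Orthogonality -/

/-- Candidates whose elements have strongly normalizing generalized absurdities; the form that
orthogonality takes for the candidates of the two weak types `A^⊕` and `A^⊖`. -/
def WeakOrthogonal (ξ ζ : RC) : Prop := ∀ a ∈ ξ.1, ∀ b ∈ ζ.1, (UTm.gabs a b).SN

/-- Only the absurdities between two canonical terms, which may reduce at the root, have to be
examined for orthogonality. -/
theorem Orthogonal.of_root
    (h : ∀ a ∈ ξ.1, ∀ b ∈ ζ.1, Can a → Can b → ∀ c, Step (.abs a b) c →
      c.SN ∨ (∃ a', Step a a' ∧ c = .abs a' b) ∨ ∃ b', Step b b' ∧ c = .abs a b') :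
    Orthogonal ξ ζ := by
  intro a ha b hb
  induction ξ.2.sn a ha generalizing b with
  | intro a _ iha =>
    induction ζ.2.sn b hb with
    | intro b _ ihb =>
      have hl : ∀ a', Step a a' → (UTm.abs a' b).SN := fun a' hs =>
        iha a' hs (ξ.2.closed _ _ ha hs) b hb
      have hr : ∀ b', Step b b' → (UTm.abs a b').SN := fun b' hs =>
        ihb b' hs (ζ.2.closed _ _ hb hs)
      refine Acc.intro _ fun c hc => ?_
      by_cases hab : Can a ∧ Can b
      · obtain h | ⟨a', hs, rfl⟩ | ⟨b', hs, rfl⟩ := h a ha b hb hab.1 hab.2 c hc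
        exacts [h, hl _ hs, hr _ hs]
      · cases hc with
        | abs₁ _ hs => exact hl _ hs
        | abs₂ _ hs => exact hr _ hs
        | _ => exact absurd ⟨by constructor, by constructor⟩ hab

theorem orthogonal_prod_sum (h₁ : WeakOrthogonal ξ₁ ζ₁) (h₂ : WeakOrthogonal ξ₂ ζ₂) :
    Orthogonal (prod ξ₁ ξ₂) (sum ζ₁ ζ₂) := by
  refine Orthogonal.of_root fun a ha b hb hca hcb c hs => ?_
  obtain ⟨a₁, ha₁, a₂, ha₂, rfl⟩ := mem_of_mem_closure ha hca
  obtain ⟨i, b, hb', rfl⟩ := mem_of_mem_closure hb hcb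
  cases hs with
  | abs_pair_inj =>
    left
    cases i
    exacts [h₁ _ ha₁ _ hb', h₂ _ ha₂ _ hb']
  | abs₁ _ hs => exact .inr (.inl ⟨_, hs, rfl⟩)
  | abs₂ _ hs => exact .inr (.inr ⟨_, hs, rfl⟩)

theorem orthogonal_sum_prod (h₁ : WeakOrthogonal ξ₁ ζ₁) (h₂ : WeakOrthogonal ξ₂ ζ₂) :
    Orthogonal (sum ξ₁ ξ₂) (prod ζ₁ ζ₂) := by
  refine Orthogonal.of_root fun a ha b hb hca hcb c hs => ?_
  obtain ⟨i, a, ha', rfl⟩ := mem_of_mem_closure ha hca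
  obtain ⟨b₁, hb₁, b₂, hb₂, rfl⟩ := mem_of_mem_closure hb hcb
  cases hs with
  | abs_inj_pair =>
    left
    cases i
    exacts [h₁ _ ha' _ hb₁, h₂ _ ha' _ hb₂]
  | abs₁ _ hs => exact .inr (.inl ⟨_, hs, rfl⟩)
  | abs₂ _ hs => exact .inr (.inr ⟨_, hs, rfl⟩)

theorem inst_mem_of_lam_mem_arrow (ha : UTm.lam a ∈ (arrow ξ ζ).1) (hb : b ∈ ξ.1) :
    a.inst b ∈ ζ.1 :=
  ζ.2.closed _ _ (ha.2 b hb) (.beta_lam _ _)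

theorem orthogonal_arrow_coarrow (h : WeakOrthogonal ξ₂ ζ) :
    Orthogonal (arrow ξ₁ ξ₂) (coarrow ξ₁ ζ) := by
  refine Orthogonal.of_root fun a ha b hb _ hcb c hs => ?_
  obtain ⟨b₁, hb₁, b₂, hb₂, rfl⟩ := mem_of_mem_closure hb hcb
  cases hs with
  | abs_lam_copair => exact .inl (h _ (inst_mem_of_lam_mem_arrow ha hb₁) _ hb₂)
  | abs₁ _ hs => exact .inr (.inl ⟨_, hs, rfl⟩)
  | abs₂ _ hs => exact .inr (.inr ⟨_, hs, rfl⟩)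

theorem orthogonal_coarrow_arrow (h : WeakOrthogonal ξ ζ₂) :
    Orthogonal (coarrow ζ₁ ξ) (arrow ζ₁ ζ₂) := by
  refine Orthogonal.of_root fun a ha b hb hca _ c hs => ?_
  obtain ⟨a₁, ha₁, a₂, ha₂, rfl⟩ := mem_of_mem_closure ha hca
  cases hs with
  | abs_copair_lam => exact .inl (h _ ha₂ _ (inst_mem_of_lam_mem_arrow hb ha₁))
  | abs₁ _ hs => exact .inr (.inl ⟨_, hs, rfl⟩)
  | abs₂ _ hs => exact .inr (.inr ⟨_, hs, rfl⟩)

/-- The candidates change sides, as in the reduction rule for the absurdity of two negations. -/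
theorem orthogonal_neg_neg (h : WeakOrthogonal ξ ζ) : Orthogonal (neg ζ) (neg ξ) := by
  refine Orthogonal.of_root fun a ha b hb hca hcb c hs => ?_
  obtain ⟨a, ha', rfl⟩ := mem_of_mem_closure ha hca
  obtain ⟨b, hb', rfl⟩ := mem_of_mem_closure hb hcb
  cases hs with
  | abs_neg => exact .inl (h _ hb' _ ha')
  | abs₁ _ hs => exact .inr (.inl ⟨_, hs, rfl⟩)
  | abs₂ _ hs => exact .inr (.inr ⟨_, hs, rfl⟩)

theorem mem_of_tlam_mem_all {ι : Type*} {ξ : ι → RC} (ha : UTm.tlam a ∈ (all ξ).1) (i : ι) :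
    a ∈ (ξ i).1 :=
  (ξ i).2.closed _ _ (ha.2 i) (.beta_tlam _)

theorem orthogonal_all_ex {ι : Type*} {ξ ζ : ι → RC} (h : ∀ i, WeakOrthogonal (ξ i) (ζ i)) :
    Orthogonal (all ξ) (ex ζ) := by
  refine Orthogonal.of_root fun a ha b hb _ hcb c hs => ?_
  obtain ⟨b, ⟨i, hb'⟩, rfl⟩ := mem_of_mem_closure hb hcb
  cases hs with
  | abs_tlam_pack => exact .inl (h i _ (mem_of_tlam_mem_all ha i) _ hb')
  | abs₁ _ hs => exact .inr (.inl ⟨_, hs, rfl⟩)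
  | abs₂ _ hs => exact .inr (.inr ⟨_, hs, rfl⟩)

theorem orthogonal_ex_all {ι : Type*} {ξ ζ : ι → RC} (h : ∀ i, WeakOrthogonal (ξ i) (ζ i)) :
    Orthogonal (ex ξ) (all ζ) := by
  refine Orthogonal.of_root fun a ha b hb hca _ c hs => ?_
  obtain ⟨a, ⟨i, ha'⟩, rfl⟩ := mem_of_mem_closure ha hca
  cases hs with
  | abs_pack_tlam => exact .inl (h i _ ha' _ (mem_of_tlam_mem_all hb i))
  | abs₁ _ hs => exact .inr (.inl ⟨_, hs, rfl⟩)
  | abs₂ _ hs => exact .inr (.inr ⟨_, hs, rfl⟩)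

theorem orthogonal_closure_empty : Orthogonal (closure ∅) (closure ∅) :=
  Orthogonal.of_root fun _ ha _ _ hca _ _ _ => (mem_of_mem_closure ha hca).elim

end RC

instance : Nonempty OrthPair := ⟨⟨(_, _), RC.orthogonal_closure_empty⟩⟩

/-! ### The interpretation of types -/

theorem reducible_wneg (A : PureTy) (ρ : Env) :
    reducible (.wneg A) ρ = (reducible (.wpos A) ρ).arrow (reducible (.neg A) ρ) := by
  rw [reducible, reducible, RC.gfp_arrowArrow]

theorem reducible_wpos (A : PureTy) (ρ : Env) :
    reducible (.wpos A) ρ = (reducible (.wneg A) ρ).arrow (reducible (.pos A) ρ) := by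
  rw [reducible_wneg, reducible, RC.arrow_lfp]

theorem app_mem_pos {A : PureTy} {ρ : Env} {a b : UTm} (ha : a ∈ (reducible (.wpos A) ρ).1)
    (hb : b ∈ (reducible (.wneg A) ρ).1) : UTm.app a b ∈ (reducible (.pos A) ρ).1 := by
  rw [reducible_wpos] at ha
  exact ha.2 b hb

theorem app_mem_neg {A : PureTy} {ρ : Env} {a b : UTm} (ha : a ∈ (reducible (.wneg A) ρ).1)
    (hb : b ∈ (reducible (.wpos A) ρ).1) : UTm.app a b ∈ (reducible (.neg A) ρ).1 := by
  rw [reducible_wneg] at ha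
  exact ha.2 b hb

theorem weakOrthogonal_of_orthogonal {A : PureTy} {ρ : Env}
    (h : RC.Orthogonal (reducible (.pos A) ρ) (reducible (.neg A) ρ)) :
    RC.WeakOrthogonal (reducible (.wpos A) ρ) (reducible (.wneg A) ρ) :=
  fun _ ha _ hb => h _ (app_mem_pos ha hb) _ (app_mem_neg hb ha)

theorem orthogonal_pos_neg (A : PureTy) (ρ : Env) :
    RC.Orthogonal (reducible (.pos A) ρ) (reducible (.neg A) ρ) := by
  induction A generalizing ρ with
  | var n =>
    rw [reducible, reducible]
    exact (ρ n).2
  | and A B ihA ihB =>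
    rw [reducible, reducible]
    exact RC.orthogonal_prod_sum (weakOrthogonal_of_orthogonal (ihA ρ))
      (weakOrthogonal_of_orthogonal (ihB ρ))
  | or A B ihA ihB =>
    rw [reducible, reducible]
    exact RC.orthogonal_sum_prod (weakOrthogonal_of_orthogonal (ihA ρ))
      (weakOrthogonal_of_orthogonal (ihB ρ))
  | imp A B _ ihB =>
    rw [reducible, reducible]
    exact RC.orthogonal_arrow_coarrow (weakOrthogonal_of_orthogonal (ihB ρ))
  | coimp A B _ ihB =>
    rw [reducible, reducible]
    exact RC.orthogonal_coarrow_arrow (weakOrthogonal_of_orthogonal (ihB ρ))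
  | neg A ihA =>
    rw [reducible, reducible]
    exact RC.orthogonal_neg_neg (weakOrthogonal_of_orthogonal (ihA ρ))
  | all A ihA =>
    rw [reducible, reducible]
    exact RC.orthogonal_all_ex fun p => weakOrthogonal_of_orthogonal (ihA _)
  | ex A ihA =>
    rw [reducible, reducible]
    exact RC.orthogonal_ex_all fun p => weakOrthogonal_of_orthogonal (ihA _)

/-- The orthogonal pair formed by the candidates of the two strong types of `A`. -/
def orthPair (A : PureTy) (ρ : Env) : OrthPair :=
  ⟨(reducible (.pos A) ρ, reducible (.neg A) ρ), orthogonal_pos_neg A ρ⟩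

theorem orthPair_var (n : ℕ) (ρ : Env) : orthPair (.var n) ρ = ρ n := by
  apply Subtype.ext
  simp only [orthPair, reducible]

theorem cons_upRen (p : OrthPair) (ρ : Env) (f : ℕ → ℕ) :
    (fun n => Env.cons p ρ (upRen f n)) = Env.cons p fun n => ρ (f n) := by
  funext n
  cases n <;> rfl

/-- The candidates of the weak types are determined by those of the strong types. -/
theorem reducible_weak_congr {A B : PureTy} {ρ ρ' : Env}
    (h : orthPair A ρ = orthPair B ρ') :
    reducible (.wpos A) ρ = reducible (.wpos B) ρ' ∧
      reducible (.wneg A) ρ = reducible (.wneg B) ρ' := by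
  simp only [orthPair, Subtype.mk.injEq, Prod.mk.injEq] at h
  simp only [reducible, h, and_self]

theorem orthPair_congr {A B : PureTy} {ρ ρ' : Env}
    (hpos : reducible (.pos A) ρ = reducible (.pos B) ρ')
    (hneg : reducible (.neg A) ρ = reducible (.neg B) ρ') : orthPair A ρ = orthPair B ρ' :=
  Subtype.ext (Prod.ext hpos hneg)

theorem orthPair_rename (A : PureTy) (f : ℕ → ℕ) (ρ : Env) :
    orthPair (A.rename f) ρ = orthPair A fun n => ρ (f n) := by
  induction A generalizing f ρ with
  | var n => simp only [PureTy.rename, orthPair_var]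
  | neg A ihA =>
    have hA := reducible_weak_congr (ihA f ρ)
    apply orthPair_congr <;> simp only [PureTy.rename, reducible.eq_def (.pos _),
      reducible.eq_def (.neg _), hA]
  | all A ihA | ex A ihA =>
    have hA := fun p => reducible_weak_congr (ihA (upRen f) (Env.cons p ρ))
    apply orthPair_congr <;> simp only [PureTy.rename, reducible.eq_def (.pos _),
      reducible.eq_def (.neg _), hA, cons_upRen]
  | _ A B ihA ihB =>
    have hA := reducible_weak_congr (ihA f ρ)
    have hB := reducible_weak_congr (ihB f ρ)
    apply orthPair_congr <;> simp only [PureTy.rename, reducible.eq_def (.pos _),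
      reducible.eq_def (.neg _), hA, hB]

theorem orthPair_up (τ : ℕ → PureTy) (p : OrthPair) (ρ : Env) :
    (fun n => orthPair (PureTy.up τ n) (Env.cons p ρ)) =
      Env.cons p fun n => orthPair (τ n) ρ := by
  funext n
  cases n with
  | zero => exact orthPair_var _ _
  | succ n => exact orthPair_rename _ _ _

theorem orthPair_subst (A : PureTy) (τ : ℕ → PureTy) (ρ : Env) :
    orthPair (A.subst τ) ρ = orthPair A fun n => orthPair (τ n) ρ := by
  induction A generalizing τ ρ with
  | var n => simp only [PureTy.subst, orthPair_var]
  | neg A ihA =>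
    have hA := reducible_weak_congr (ihA τ ρ)
    apply orthPair_congr <;> simp only [PureTy.subst, reducible.eq_def (.pos _),
      reducible.eq_def (.neg _), hA]
  | all A ihA | ex A ihA =>
    have hA := fun p => reducible_weak_congr (ihA (PureTy.up τ) (Env.cons p ρ))
    apply orthPair_congr <;> simp only [PureTy.subst, reducible.eq_def (.pos _),
      reducible.eq_def (.neg _), hA, orthPair_up]
  | _ A B ihA ihB =>
    have hA := reducible_weak_congr (ihA τ ρ)
    have hB := reducible_weak_congr (ihB τ ρ)
    apply orthPair_congr <;> simp only [PureTy.subst, reducible.eq_def (.pos _),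
      reducible.eq_def (.neg _), hA, hB]

/-- Substituting types for type variables amounts to changing the environment. -/
theorem reducible_subst (P : Ty) (τ : ℕ → PureTy) (ρ : Env) :
    reducible (P.subst τ) ρ = reducible P fun n => orthPair (τ n) ρ := by
  cases P with
  | pos A => exact congrArg (fun p : OrthPair => p.1.1) (orthPair_subst A τ ρ)
  | neg A => exact congrArg (fun p : OrthPair => p.1.2) (orthPair_subst A τ ρ)
  | wpos A => exact (reducible_weak_congr (orthPair_subst A τ ρ)).1
  | wneg A => exact (reducible_weak_congr (orthPair_subst A τ ρ)).2

theorem reducible_tshift (P : Ty) (p : OrthPair) (ρ : Env) :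
    reducible P.tshift (Env.cons p ρ) = reducible P ρ := by
  rw [Ty.tshift, reducible_subst]
  congr 1
  funext n
  exact orthPair_var _ _

theorem orthPair_single (A : PureTy) (ρ : Env) :
    (fun n => orthPair (PureTy.single A n) ρ) = Env.cons (orthPair A ρ) ρ := by
  funext n
  cases n with
  | zero => rfl
  | succ n => exact orthPair_var _ _

theorem reducible_wpos_inst (A B : PureTy) (ρ : Env) :
    reducible (.wpos (B.inst A)) ρ = reducible (.wpos B) (Env.cons (orthPair A ρ) ρ) := by
  rw [← orthPair_single]
  exact reducible_subst (.wpos B) _ ρ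

theorem reducible_wneg_inst (A B : PureTy) (ρ : Env) :
    reducible (.wneg (B.inst A)) ρ = reducible (.wneg B) (Env.cons (orthPair A ρ) ρ) := by
  rw [← orthPair_single]
  exact reducible_subst (.wneg B) _ ρ

/-! ### Adequacy -/

theorem Adequate.cons {σ : ℕ → UTm} {ρ : Env} {Γ : Ctx} (h : Adequate σ ρ Γ) {P : Ty} {a : UTm}
    (ha : a ∈ (reducible P ρ).1) : Adequate (UTm.scons a σ) ρ (Γ.cons P) := by
  rintro (_ | x) Q hx
  · obtain rfl : P = Q := Option.some.inj hx
    exact ha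
  · exact h x Q hx

theorem Adequate.tshift {σ : ℕ → UTm} {ρ : Env} {Γ : Ctx} (h : Adequate σ ρ Γ) (p : OrthPair) :
    Adequate σ (Env.cons p ρ) Γ.tshift := by
  intro x Q hx
  obtain ⟨P, hP, rfl⟩ := Option.map_eq_some_iff.mp hx
  rw [reducible_tshift]
  exact h x P hP

theorem reducible_wpos_pick (i : Idx) (A B : PureTy) (ρ : Env) :
    reducible (.wpos (i.pick A B)) ρ =
      i.pick (reducible (.wpos A) ρ) (reducible (.wpos B) ρ) := by
  cases i <;> rfl

theorem reducible_wneg_pick (i : Idx) (A B : PureTy) (ρ : Env) :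
    reducible (.wneg (i.pick A B)) ρ =
      i.pick (reducible (.wneg A) ρ) (reducible (.wneg B) ρ) := by
  cases i <;> rfl

theorem adequacy {Γ : Ctx} {t : Tm} {P : Ty} (ht : HasType Γ t P) {ρ : Env} {σ : ℕ → UTm}
    (hσ : Adequate σ ρ Γ) : t.erase.subst σ ∈ (reducible P ρ).1 := by
  induction ht generalizing ρ σ with
  | ax hx => exact hσ _ _ hx
  | @abs _ _ _ A P _ _ iht ihs =>
    exact RC.abs_mem _ (orthogonal_pos_neg A ρ _ (iht hσ) _ (ihs hσ))
  | wlam_pos _ ih =>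
    rw [reducible_wpos]
    exact RC.lam_mem_arrow fun b hb => by
      rw [UTm.inst_subst_up]
      exact ih (hσ.cons hb)
  | wlam_neg _ ih =>
    rw [reducible_wneg]
    exact RC.lam_mem_arrow fun b hb => by
      rw [UTm.inst_subst_up]
      exact ih (hσ.cons hb)
  | wapp_pos _ _ iht ihs => exact app_mem_pos (iht hσ) (ihs hσ)
  | wapp_neg _ _ iht ihs => exact app_mem_neg (iht hσ) (ihs hσ)
  | pair_pos _ _ iht ihs | pair_neg _ _ iht ihs =>
    rw [reducible]
    exact RC.pair_mem_prod (iht hσ) (ihs hσ)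
  | proj_pos i _ ih =>
    specialize ih hσ
    rw [reducible] at ih
    rw [reducible_wpos_pick]
    exact RC.proj_mem i ih
  | proj_neg i _ ih =>
    specialize ih hσ
    rw [reducible] at ih
    rw [reducible_wneg_pick]
    exact RC.proj_mem i ih
  | inj_pos i _ ih =>
    specialize ih hσ
    rw [reducible_wpos_pick] at ih
    rw [reducible]
    exact RC.inj_mem_sum i ih
  | inj_neg i _ ih =>
    specialize ih hσ
    rw [reducible_wneg_pick] at ih
    rw [reducible]
    exact RC.inj_mem_sum i ih
  | case_pos _ _ _ iht ihs ihu | case_neg _ _ _ iht ihs ihu =>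
    specialize iht hσ
    rw [reducible] at iht
    refine RC.case_mem iht (fun d hd => ?_) fun d hd => ?_ <;> rw [UTm.inst_subst_up]
    exacts [ihs (hσ.cons hd), ihu (hσ.cons hd)]
  | lam_pos _ ih | lam_neg _ ih =>
    rw [reducible]
    exact RC.lam_mem_arrow fun b hb => by
      rw [UTm.inst_subst_up]
      exact ih (hσ.cons hb)
  | app_pos _ _ iht ihs | app_neg _ _ iht ihs =>
    specialize iht hσ
    rw [reducible] at iht
    exact iht.2 _ (ihs hσ)
  | copair_pos _ _ iht ihs | copair_neg _ _ iht ihs =>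
    rw [reducible]
    exact RC.copair_mem_coarrow (iht hσ) (ihs hσ)
  | colam_pos _ _ iht ihs | colam_neg _ _ iht ihs =>
    specialize iht hσ
    rw [reducible] at iht
    refine RC.colam_mem iht fun d hd e he => ?_
    rw [UTm.inst₂_subst_up_up]
    exact ihs ((hσ.cons hd).cons he)
  | negi_pos _ ih | negi_neg _ ih =>
    rw [reducible]
    exact RC.negi_mem_neg (ih hσ)
  | nege_pos _ ih | nege_neg _ ih =>
    specialize ih hσ
    rw [reducible] at ih
    exact RC.nege_mem ih
  | tlam_pos _ ih | tlam_neg _ ih =>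
    rw [reducible]
    exact RC.tlam_mem_all fun p => ih (hσ.tshift p)
  | tapp_pos A _ ih =>
    specialize ih hσ
    rw [reducible] at ih
    rw [reducible_wpos_inst]
    exact ih.2 (orthPair A ρ)
  | tapp_neg A _ ih =>
    specialize ih hσ
    rw [reducible] at ih
    rw [reducible_wneg_inst]
    exact ih.2 (orthPair A ρ)
  | @pack_pos _ _ A _ _ ih =>
    specialize ih hσ
    rw [reducible_wpos_inst] at ih
    rw [reducible]
    exact RC.pack_mem_ex (orthPair A ρ) ih
  | @pack_neg _ _ A _ _ ih =>
    specialize ih hσ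
    rw [reducible_wneg_inst] at ih
    rw [reducible]
    exact RC.pack_mem_ex (orthPair A ρ) ih
  | opn_pos _ _ iht ihs | opn_neg _ _ iht ihs =>
    specialize iht hσ
    rw [reducible] at iht
    refine RC.opn_mem iht fun p d hd => ?_
    rw [UTm.inst_subst_up, ← reducible_tshift _ p]
    exact ihs ((hσ.tshift p).cons hd)

/-! ### Erasure -/

namespace UTm

/-- The substitution of `a` for the variable with index `k`, which disappears: larger indices go
down by one. -/
def single (k : ℕ) (a : UTm) (x : ℕ) : UTm :=
  if x < k then var x else if x = k then a else var (x - 1)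

theorem up_single (k : ℕ) (a : UTm) : up (single k a) = single (k + 1) (a.rename Nat.succ) := by
  funext x
  cases x with
  | zero => rfl
  | succ x =>
    simp only [up, single]
    split_ifs <;> first | omega | rfl | skip
    all_goals simp only [rename]; congr 1; omega

theorem single_zero (a : UTm) : single 0 a = scons a var := by
  funext x
  cases x <;> rfl

end UTm

namespace Tm

theorem erase_tsubst (t : Tm) (τ : ℕ → PureTy) : (t.tsubst τ).erase = t.erase := by
  induction t generalizing τ <;> simp_all [tsubst, erase]

theorem erase_rename (t : Tm) (f : ℕ → ℕ) : (t.rename f).erase = t.erase.rename f := by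
  induction t generalizing f <;> simp_all [rename, erase, UTm.rename]

theorem erase_shift (t : Tm) : t.shift.erase = t.erase.rename Nat.succ :=
  erase_rename t _

theorem erase_tshift (t : Tm) : t.tshift.erase = t.erase :=
  erase_tsubst t _

theorem erase_subst (t : Tm) (k : ℕ) (r : Tm) :
    (t.subst k r).erase = t.erase.subst (UTm.single k r.erase) := by
  induction t generalizing k r with
  | var x P =>
    simp only [subst, erase, UTm.subst, UTm.single]
    split_ifs <;> rfl
  | _ => simp_all [subst, erase, UTm.subst, UTm.up_single, erase_shift, erase_tshift]

theorem erase_inst (t r : Tm) : (t.inst r).erase = t.erase.inst r.erase := by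
  rw [inst, erase_subst, UTm.single_zero, UTm.inst]

theorem erase_tinst (t : Tm) (A : PureTy) : (t.tinst A).erase = t.erase :=
  erase_tsubst t _

theorem erase_inst₂ (u t s : Tm) : (u.inst₂ t s).erase = u.erase.inst₂ t.erase s.erase := by
  rw [inst₂, erase_subst, erase_subst, erase_shift, UTm.subst_subst, UTm.single_zero, UTm.inst₂]
  congr 1
  funext x
  obtain _ | _ | x := x
  · rfl
  · exact (UTm.rename_succ_subst_scons _ _ _).trans (UTm.subst_var _)
  · rfl

theorem erase_pick (i : Idx) (t s : Tm) : (i.pick t s).erase = i.pick t.erase s.erase := by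
  cases i <;> rfl

theorem Step.erase {t s : Tm} (h : Step t s) : UTm.Step t.erase s.erase := by
  induction h <;>
    simp only [Tm.erase, absWpos, absWneg, erase_pick, erase_inst, erase_inst₂, erase_tinst] <;>
    first
    | (constructor; done)
    | (constructor; assumption)

theorem SN.of_erase {t : Tm} (h : t.erase.SN) : t.SN :=
  Subrelation.accessible (fun hs => Step.erase hs) (InvImage.accessible Tm.erase h)

end Tm

theorem HasType.sn {Γ : Ctx} {t : Tm} {P : Ty} (ht : HasType Γ t P) : t.SN := by
  have ρ : Env := fun _ => Classical.arbitrary OrthPair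
  have h := adequacy ht (ρ := ρ) (σ := UTm.var) fun x P _ => RC.var_mem _ x
  rw [UTm.subst_var] at h
  exact Tm.SN.of_erase ((reducible P ρ).2.sn _ h)

end PRK

theorem mainTheorem2 :
    (∀ (Γ : PRK.Ctx) (t : PRK.Tm) (P : PRK.Ty) (ρ : PRK.Env) (σ : ℕ → PRK.UTm),
      PRK.HasType Γ t P → PRK.Adequate σ ρ Γ →
        t.erase.subst σ ∈ (PRK.reducible P ρ).1) ∧
    (∀ (Γ : PRK.Ctx) (t : PRK.Tm) (P : PRK.Ty), PRK.HasType Γ t P → t.SN) :=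
  ⟨fun _ _ _ _ _ ht hσ => PRK.adequacy ht hσ, fun _ _ _ ht => ht.sn⟩
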